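/- Let $d\ge 3$ be an integer and let $\lambda=\lceil (d-2)/2\rceil$. Let $\mathbb S^{d-1}$ be the unit sphere of $\mathbb R^d$ with geodesic distance $\mathrm d(x,y)=\arccos\langle x,y\rangle$. A continuous function $g:[0,\pi]\to\mathbb R$ is called positive definite (respectively, strictly positive definite) on $\mathbb S^{d-1}$ if for every $N\in\mathbb N$ and all distinct points $x_1,\dots,x_N\in\mathbb S^{d-1}$ the matrix $[g(\mathrm d(x_i,x_j))]_{i,j=1}^N$ is nonnegative definite (respectively, positive definite). Let $g\in C^{\lambda}[0,\pi]$ be real-valued, with derivatives at the endpoints of $[0,\pi]$ understood as one-sided, and suppose that (i) $(-1)^\lambda g^{(\lambda)}$ is convex on $[0,\pi]$; (ii) $g^{(j)}(\pi)=0$ for $0\le j\le\lambda$, the left derivative of $g^{(\lambda)}$ at $\pi$ exists and $g^{(\lambda+1)}(\pi)=0$, and the right derivative $g^{(\lambda+1)}(0)$ of $g^{(\lambda)}$ at $0$ exists and is finite. Then $g$ is positive definite on $\mathbb S^{d-1}$. If, in addition, $g^{(\lambda)}$ is not a polynomial of degree at most one on $[0,\pi]$ (that is, not of the form $\theta\mapsto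 a\theta+b$ with $a,b\in\mathbb R$, constants included), then $g$ is strictly positive definite on $\mathbb S^{d-1}$. -/

import Mathlib

/-- The geodesic distance `arccos ⟨x, y⟩` on the unit sphere of `ℝ^d`. -/
noncomputable def sphereDist {d : ℕ}
    (x y : Metric.sphere (0 : EuclideanSpace ℝ (Fin d)) 1) : ℝ :=
  Real.arccos (inner ℝ (x : EuclideanSpace ℝ (Fin d)) (y : EuclideanSpace ℝ (Fin d)))

/-- The `N × N` matrix `g [X_N] = (g (d (x_i, x_j)))_{i,j}`. -/
noncomputable def sphereMatrix {d N : ℕ} (g : ℝ → ℝ)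
    (x : Fin N → Metric.sphere (0 : EuclideanSpace ℝ (Fin d)) 1) : Matrix (Fin N) (Fin N) ℝ :=
  Matrix.of fun i j => g (sphereDist (x i) (x j))

/-- A function `g`, continuous on `[0, π]`, is positive definite on the unit sphere of `ℝ^d` if
`g [X_N]` is nonnegative definite for every finite family of distinct points.  Only the values of
`g` on `[0, π]` are used. -/
def IsSpherePosDef (d : ℕ) (g : ℝ → ℝ) : Prop :=
  ContinuousOn g (Set.Icc 0 Real.pi) ∧
    ∀ (N : ℕ) (x : Fin N → Metric.sphere (0 : EuclideanSpace ℝ (Fin d)) 1),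
      Function.Injective x → (sphereMatrix g x).PosSemidef

/-- A function `g`, continuous on `[0, π]`, is strictly positive definite on the unit sphere of
`ℝ^d` if `g [X_N]` is positive definite for every finite family of distinct points. -/
def IsSphereStrictPosDef (d : ℕ) (g : ℝ → ℝ) : Prop :=
  ContinuousOn g (Set.Icc 0 Real.pi) ∧
    ∀ (N : ℕ) (x : Fin N → Metric.sphere (0 : EuclideanSpace ℝ (Fin d)) 1),
      Function.Injective x → (sphereMatrix g x).PosDef

/-- The `j`-th derivative of `g` on the interval `[0, π]`, one-sided at the endpoints. -/
noncomputable def derivOnIcc (j : ℕ) (g : ℝ → ℝ) : ℝ → ℝ :=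
  iteratedDerivWithin j g (Set.Icc 0 Real.pi)

/-! Write `m` for `lam`. The function `(-1)^m g^(m)` is convex and vanishes with its slope at `π`,
so it is `∫_θ^π k` for a bounded nonnegative decreasing `k`
(`ConvexLayer.exists_antitone_integral`). The layer-cake formula with a generalized inverse `τ` of
`k` turns this into `∫_0^K (τ(s) - θ)₊ ds`. Integrating `m` more times from `π`, where the lower
derivatives vanish, exhibits `g` as a positive mixture of the truncated powers `(τ(s) - θ)₊^(m+1)`
(`ConvexLayer.eq_integral_truncPow`). It then suffices that each such power with `τ(s) > 0` is
strictly positive definite. Since `d ≤ 2m + 2`, padding by zeros allows working in dimension `2m +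
2`.

There the zonal polynomials are those of index `m`, that is, normalized `m`-th derivatives of
Chebyshev polynomials. Each is a positive definite kernel, being a positive multiple of a Gram
kernel of harmonic polynomials in the Fischer inner product (`Fischer.sum_mul_eval_nonneg`). The
coefficients of a truncated power are repeated integrals of the weighted polynomials; passing from
index `m` to `m + 1` amounts to solving `y''' + ν² y' = f` with zero initial data, whose kernel `(1
- cos ν(t - s)) / ν²` is nonnegative (`Ultra.truncCoeff_succ`). Hence all coefficients are positive
once `m ≥ 1`. They are also summable, so the expansion converges to the truncated power
(`Ultra.hasSum_truncPow`). If a quadratic form vanished, it would vanish for every polynomial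
kernel, which forces the vector to be zero (`Ultra.sum_mul_truncPow_pos`). -/

open Polynomial in
/-- The ultraspherical polynomial of degree `n` and index `m`, normalized to be `1` at `1`. -/
noncomputable def ultra (m n : ℕ) : ℝ[X] :=
  C ((derivative^[m] (Chebyshev.T ℝ ((n + m : ℕ) : ℤ))).eval 1)⁻¹ *
    derivative^[m] (Chebyshev.T ℝ ((n + m : ℕ) : ℤ))

/-- The differential equation of ultraspherical polynomials of degree `n` and index `m`. -/
def UltraODE (m n : ℕ) (p : Polynomial ℝ) : Prop :=
  (1 - Polynomial.X ^ 2) * Polynomial.derivative (Polynomial.derivative p) =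
    Polynomial.C (2 * m + 1 : ℝ) * Polynomial.X * Polynomial.derivative p -
      Polynomial.C (n * (n + 2 * m) : ℝ) * p

/-! ### Ultraspherical polynomials: differential equation, degree and bounds -/

namespace Ultra

open Polynomial Real

lemma eval_one_iterate_derivative_T_pos {m N : ℕ} (h : m ≤ N) :
    0 < (derivative^[m] (Chebyshev.T ℝ (N : ℤ))).eval 1 := by
  rw [Chebyshev.iterate_derivative_T_eval_one_eq_div]
  push_cast
  refine div_pos (Finset.prod_pos fun l hl => ?_) (Finset.prod_pos fun l _ => by positivity)
  have h1 : (l : ℝ) + 1 ≤ N := by exact_mod_cast (Finset.mem_range.1 hl).trans_le h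
  have h2 : (0 : ℝ) ≤ l := l.cast_nonneg
  nlinarith

lemma eval_one (m n : ℕ) : (ultra m n).eval 1 = 1 := by
  have := eval_one_iterate_derivative_T_pos (Nat.le_add_left m n)
  rw [ultra, eval_mul, eval_C, inv_mul_cancel₀ this.ne']

/-- This is the Chebyshev equation differentiated `m` times, with `(n + m)² - m² = n (n + 2m)`. -/
lemma ode_T (m n : ℕ) : UltraODE m n (derivative^[m] (Chebyshev.T ℝ ((n + m : ℕ) : ℤ))) := by
  have h := Chebyshev.one_sub_X_sq_mul_iterate_derivative_T_eq_poly_in_T (R := ℝ) ((n + m : ℕ) : ℤ) m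
  rw [Function.iterate_succ_apply', Function.iterate_succ_apply'] at h
  rw [UltraODE, h]
  simp only [C_add, C_mul, C_1, map_natCast, map_ofNat]
  push_cast
  ring

lemma _root_.UltraODE.const_mul {m n : ℕ} {p : ℝ[X]} (hp : UltraODE m n p) (c : ℝ) :
    UltraODE m n (C c * p) := by
  unfold UltraODE at *
  simp only [derivative_C_mul]
  linear_combination C c * hp

lemma ode (m n : ℕ) : UltraODE m n (ultra m n) := (ode_T m n).const_mul _

lemma coeff_iterate_derivative_T_pos (m n : ℕ) :
    0 < (derivative^[m] (Chebyshev.T ℝ ((n + m : ℕ) : ℤ))).coeff n := by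
  rw [coeff_iterate_derivative]
  have h : (Chebyshev.T ℝ ((n + m : ℕ) : ℤ)).coeff (n + m) = 2 ^ (n + m - 1) := by
    have h1 := Chebyshev.leadingCoeff_T (R := ℝ) ((n + m : ℕ) : ℤ)
    rwa [leadingCoeff, Chebyshev.natDegree_T, Int.natAbs_natCast] at h1
  rw [h]
  have : 0 < (n + m).descFactorial m := Nat.descFactorial_pos.2 (Nat.le_add_left m n)
  rw [nsmul_eq_mul]
  positivity

lemma natDegree_iterate_derivative_T (m n : ℕ) :
    (derivative^[m] (Chebyshev.T ℝ ((n + m : ℕ) : ℤ))).natDegree = n := by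
  have h := coeff_iterate_derivative_T_pos m n
  refine le_antisymm ((natDegree_iterate_derivative _ _).trans ?_) (le_natDegree_of_ne_zero h.ne')
  rw [Chebyshev.natDegree_T, Int.natAbs_natCast, Nat.add_sub_cancel]

lemma natDegree_eq (m n : ℕ) : (ultra m n).natDegree = n := by
  have := eval_one_iterate_derivative_T_pos (Nat.le_add_left m n)
  rw [ultra, natDegree_C_mul (inv_ne_zero this.ne'), natDegree_iterate_derivative_T]

lemma coeff_self_pos (m n : ℕ) : 0 < (ultra m n).coeff n := by
  have := eval_one_iterate_derivative_T_pos (Nat.le_add_left m n)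
  rw [ultra, coeff_C_mul]
  exact mul_pos (inv_pos.2 this) (coeff_iterate_derivative_T_pos m n)

lemma abs_eval_le_one (m n : ℕ) {x : ℝ} (hx : |x| ≤ 1) : |(ultra m n).eval x| ≤ 1 := by
  have := eval_one_iterate_derivative_T_pos (Nat.le_add_left m n)
  rw [ultra, eval_mul, eval_C, abs_mul, abs_of_pos (inv_pos.2 this), inv_mul_le_iff₀ this, mul_one]
  exact Chebyshev.abs_iterate_derivative_T_real_le _ _ hx

/-- Two polynomial solutions of the differential equation with the same value at `1` agree. -/
lemma _root_.UltraODE.eq_zero {m n : ℕ} {p : ℝ[X]} (hp : UltraODE m n p) (h1 : p.eval 1 = 0) :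
    p = 0 := by
  -- Differentiate the equation `k` times. At `1` the leading factor `1 - X²` vanishes, so each
  -- derivative there is determined by the preceding one.
  have key : ∀ k : ℕ, (1 - X ^ 2) * derivative^[k + 2] p =
      C (2 * (m + k) + 1 : ℝ) * X * derivative^[k + 1] p -
        C ((n - k) * (n + 2 * m + k) : ℝ) * derivative^[k] p := by
    intro k
    induction k with
    | zero =>
      have := hp
      unfold UltraODE at this
      simpa using this
    | succ k ih =>
      have h := congr_arg derivative ih
      simp only [derivative_mul, derivative_sub, derivative_C, derivative_X, derivative_one,
        derivative_X_pow, ← Function.iterate_succ_apply'] at h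
      simp only [C_add, C_mul, C_sub, C_1, map_natCast, map_ofNat, Nat.cast_add, Nat.cast_one,
        Nat.succ_eq_add_one] at h ⊢
      linear_combination h
  have h0 : ∀ k : ℕ, (derivative^[k] p).eval 1 = 0 := by
    intro k
    induction k with
    | zero => simpa using h1
    | succ k ih =>
      have h := congr_arg (eval 1) (key k)
      simp [ih] at h
      have h2 : (2 * (m + k) + 1 : ℝ) ≠ 0 := by positivity
      rcases h with h | h
      · exact absurd h h2
      · exact h
  have : taylor 1 p = 0 := by
    ext k
    rw [taylor_coeff, coeff_zero]
    have h := h0 k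
    rw [← factorial_smul_hasseDeriv, LinearMap.smul_apply, eval_smul] at h
    simpa [Nat.factorial_ne_zero] using h
  exact (taylor_eq_zero 1 p).1 this

lemma _root_.UltraODE.eq_of_eval {m n : ℕ} {p q : ℝ[X]} (hp : UltraODE m n p) (hq : UltraODE m n q)
    (h : p.eval 1 = q.eval 1) : p = q := by
  rw [← sub_eq_zero]
  refine UltraODE.eq_zero (m := m) (n := n) ?_ (by simp [h])
  unfold UltraODE at *
  simp only [derivative_sub]
  linear_combination hp - hq

/-- Expression of an ultraspherical polynomial by one whose index is larger by one. -/
lemma lowering (m n : ℕ) :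
    C (2 * m + 1 : ℝ) * X ^ 2 * ultra (m + 1) n +
      C (n + 2 * m + 1 : ℝ) * (1 - X ^ 2) * ultra (m + 1) n -
      X * (1 - X ^ 2) * derivative (ultra (m + 1) n) = C (2 * m + 1 : ℝ) * ultra m n := by
  set p := ultra (m + 1) n with hp
  have ho := ode (m + 1) n
  rw [← hp] at ho
  -- Both sides solve the equation of index `m` and equal `2m + 1` at `1`. The equation for `p`
  -- removes its higher derivatives from `E'` and `E''`.
  refine UltraODE.eq_of_eval (m := m) (n := n) ?_ ((ode m n).const_mul _) ?_
  · unfold UltraODE at ho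
    set E := C (2 * m + 1 : ℝ) * X ^ 2 * p + C (n + 2 * m + 1 : ℝ) * (1 - X ^ 2) * p -
      X * (1 - X ^ 2) * derivative p with hE
    have h1 : derivative E = C (n + 2 * m : ℝ) * (C (n : ℝ) * X * p +
        (1 - X ^ 2) * derivative p) := by
      rw [hE]
      simp only [derivative_mul, derivative_sub, derivative_add, derivative_C, derivative_X,
        derivative_one, derivative_X_pow]
      simp only [C_add, C_mul, C_1, map_natCast, map_ofNat, Nat.cast_add, Nat.cast_one] at ho ⊢
      linear_combination -X * ho
    have h2 : derivative (derivative E) = C (n + 2 * m : ℝ) * (C (n + 2 * m + 1 : ℝ) *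
        (X * derivative p - C (n : ℝ) * p)) := by
      rw [h1]
      simp only [derivative_mul, derivative_sub, derivative_add, derivative_C, derivative_X,
        derivative_one, derivative_X_pow]
      simp only [C_add, C_mul, C_1, map_natCast, map_ofNat, Nat.cast_add, Nat.cast_one] at ho ⊢
      linear_combination ((n : ℝ[X]) + 2 * m) * ho
    unfold UltraODE
    rw [h2, h1, hE]
    simp only [C_add, C_mul, C_1, map_natCast, map_ofNat]
    ring
  · simp [hp, eval_one]

/-! ### Orthogonality and norms -/

lemma hasDerivAt_eval_cos (p : ℝ[X]) (θ : ℝ) :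
    HasDerivAt (fun θ => p.eval (cos θ)) (-(sin θ * (derivative p).eval (cos θ))) θ := by
  have := (p.hasDerivAt (cos θ)).comp θ (hasDerivAt_cos θ)
  refine this.congr_deriv ?_
  ring

lemma continuous_eval_cos (p : ℝ[X]) : Continuous fun θ => p.eval (cos θ) :=
  p.continuous.comp continuous_cos

/-- In Sturm–Liouville form the equation says that `sin^(2m+1) · p'(cos)` has derivative `c ·
sin^(2m) · p(cos)`. Integrate by parts against `r(cos)`; the boundary terms contain a factor `sin`.
Iterating this reduces orthogonality to that of the cosines. -/
lemma integral_derivative_mul_derivative (m : ℕ) (c : ℝ) (p r : ℝ[X])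
    (hp : (1 - X ^ 2) * derivative (derivative p) =
      C (2 * m + 1 : ℝ) * X * derivative p - C c * p) :
    ∫ θ in (0)..π, (derivative p).eval (cos θ) * (derivative r).eval (cos θ) *
      sin θ ^ (2 * (m + 1)) =
    c * ∫ θ in (0)..π, p.eval (cos θ) * r.eval (cos θ) * sin θ ^ (2 * m) := by
  have hd : ∀ θ ∈ Set.uIcc 0 π, HasDerivAt
      (fun θ => sin θ ^ (2 * m + 1) * (derivative p).eval (cos θ) * r.eval (cos θ))
      (c * (p.eval (cos θ) * r.eval (cos θ) * sin θ ^ (2 * m)) -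
        (derivative p).eval (cos θ) * (derivative r).eval (cos θ) * sin θ ^ (2 * (m + 1))) θ := by
    intro θ _
    have h := (((hasDerivAt_sin θ).pow (2 * m + 1)).mul
      (hasDerivAt_eval_cos (derivative p) θ)).mul (hasDerivAt_eval_cos r θ)
    refine h.congr_deriv ?_
    have h1 := congr_arg (eval (cos θ)) hp
    simp only [eval_mul, eval_sub, Polynomial.eval_one, eval_pow, eval_X, eval_C] at h1
    rw [← sin_sq] at h1
    push_cast
    simp only [Pi.mul_apply, Pi.pow_apply]
    linear_combination (-sin θ ^ (2 * m) * r.eval (cos θ)) * h1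
  have hc : ∀ p : ℝ[X], Continuous fun θ => p.eval (cos θ) := continuous_eval_cos
  have h1 := hc p
  have h2 := hc r
  have h3 := hc (derivative p)
  have h4 := hc (derivative r)
  have h := intervalIntegral.integral_eq_sub_of_hasDerivAt hd
    (Continuous.intervalIntegrable (by fun_prop) _ _)
  rw [intervalIntegral.integral_sub (Continuous.intervalIntegrable (by fun_prop) _ _)
    (Continuous.intervalIntegrable (by fun_prop) _ _), intervalIntegral.integral_const_mul] at h
  simp only [sin_pi, sin_zero] at h
  simp at h
  linarith

lemma integral_iterate_derivative_T (m N M : ℕ) :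
    ∫ θ in (0)..π, (derivative^[m] (Chebyshev.T ℝ (N : ℤ))).eval (cos θ) *
      (derivative^[m] (Chebyshev.T ℝ (M : ℤ))).eval (cos θ) * sin θ ^ (2 * m) =
    (∏ k ∈ Finset.range m, ((N : ℝ) ^ 2 - k ^ 2)) *
      ∫ θ in (0)..π, (Chebyshev.T ℝ (N : ℤ)).eval (cos θ) *
        (Chebyshev.T ℝ (M : ℤ)).eval (cos θ) := by
  induction m with
  | zero => simp
  | succ m ih =>
    rw [Finset.prod_range_succ, mul_comm (∏ k ∈ Finset.range m, _), mul_assoc, ← ih]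
    simp only [Function.iterate_succ_apply']
    refine integral_derivative_mul_derivative m _ _ _ ?_
    have h := Chebyshev.one_sub_X_sq_mul_iterate_derivative_T_eq_poly_in_T (R := ℝ) (N : ℤ) m
    rw [Function.iterate_succ_apply', Function.iterate_succ_apply'] at h
    rw [h]
    simp only [C_add, C_mul, C_1, C_sub, C_pow, map_natCast, map_ofNat]
    push_cast
    ring

lemma integral_ultra_mul_ultra (m n k : ℕ) :
    ∫ θ in (0)..π, (ultra m n).eval (cos θ) * (ultra m k).eval (cos θ) * sin θ ^ (2 * m) =
    ((derivative^[m] (Chebyshev.T ℝ ((n + m : ℕ) : ℤ))).eval 1)⁻¹ *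
    ((derivative^[m] (Chebyshev.T ℝ ((k + m : ℕ) : ℤ))).eval 1)⁻¹ *
    ((∏ l ∈ Finset.range m, (((n + m : ℕ) : ℝ) ^ 2 - l ^ 2)) *
      ∫ θ in (0)..π, (Chebyshev.T ℝ ((n + m : ℕ) : ℤ)).eval (cos θ) *
        (Chebyshev.T ℝ ((k + m : ℕ) : ℤ)).eval (cos θ)) := by
  rw [← integral_iterate_derivative_T, ← intervalIntegral.integral_const_mul]
  refine intervalIntegral.integral_congr fun θ _ => ?_
  simp only [ultra, eval_mul, eval_C]
  ring

lemma integral_ultra_of_ne (m : ℕ) {n k : ℕ} (h : n ≠ k) :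
    ∫ θ in (0)..π, (ultra m n).eval (cos θ) * (ultra m k).eval (cos θ) * sin θ ^ (2 * m) = 0 := by
  have h1 := Chebyshev.integral_eval_T_real_mul_eval_T_real_measureT_of_ne
    (n := n + m) (m := k + m) (by omega)
  rw [Chebyshev.integral_measureT_eq_integral_cos] at h1
  rw [integral_ultra_mul_ultra, h1]
  simp

/-- The squared norm of an ultraspherical polynomial. -/
noncomputable def normSq (m n : ℕ) : ℝ :=
  ∫ θ in (0)..π, (ultra m n).eval (cos θ) * (ultra m n).eval (cos θ) * sin θ ^ (2 * m)

lemma normSq_eq {m : ℕ} (hm : 1 ≤ m) (n : ℕ) :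
    normSq m n = π / 2 * (∏ l ∈ Finset.range m, (2 * l + 1 : ℝ)) ^ 2 /
      ∏ l ∈ Finset.range m, (((n + m : ℕ) : ℝ) ^ 2 - l ^ 2) := by
  -- With `m ≥ 1` the degree `n + m` is never `0`, the one degree where the Chebyshev norm is not `π
  -- / 2`.
  have h1 := Chebyshev.integral_T_real_mul_self_measureT_of_ne_zero (n := n + m) (by omega)
  rw [Chebyshev.integral_measureT_eq_integral_cos] at h1
  rw [normSq, integral_ultra_mul_ultra, h1, Chebyshev.iterate_derivative_T_eval_one_eq_div]
  have h2 : 0 < ∏ l ∈ Finset.range m, (((n + m : ℕ) : ℝ) ^ 2 - l ^ 2) := by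
    refine Finset.prod_pos fun l hl => ?_
    have h1 : (l : ℝ) + 1 ≤ (n + m : ℕ) := by
      exact_mod_cast (Finset.mem_range.1 hl).trans_le (Nat.le_add_left m n)
    have h2 : (0 : ℝ) ≤ l := l.cast_nonneg
    nlinarith
  have h3 : 0 < ∏ l ∈ Finset.range m, (2 * l + 1 : ℝ) :=
    Finset.prod_pos fun l hl => by positivity
  push_cast at h2 ⊢
  field_simp

lemma normSq_pos {m : ℕ} (hm : 1 ≤ m) (n : ℕ) : 0 < normSq m n := by
  rw [normSq_eq hm]
  refine div_pos (mul_pos (by positivity) (pow_pos (Finset.prod_pos fun l hl => by positivity) 2))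
    (Finset.prod_pos fun l hl => ?_)
  have h1 : (l : ℝ) + 1 ≤ (n + m : ℕ) := by
    exact_mod_cast (Finset.mem_range.1 hl).trans_le (Nat.le_add_left m n)
  have h2 : (0 : ℝ) ≤ l := l.cast_nonneg
  nlinarith

lemma inv_normSq_le {m : ℕ} (hm : 1 ≤ m) (n : ℕ) :
    (normSq m n)⁻¹ ≤ (n + m : ℝ) ^ (2 * m) := by
  rw [normSq_eq hm, inv_div]
  have h3 : 1 ≤ (∏ l ∈ Finset.range m, (2 * l + 1 : ℝ)) :=
    calc (1 : ℝ) = ∏ l ∈ Finset.range m, (1 : ℝ) := by simp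
      _ ≤ _ := Finset.prod_le_prod (fun _ _ => zero_le_one) fun l _ => by simp
  have h4 : ∏ l ∈ Finset.range m, (((n + m : ℕ) : ℝ) ^ 2 - l ^ 2) ≤ (n + m : ℝ) ^ (2 * m) := by
    rw [pow_mul]
    calc _ ≤ ∏ l ∈ Finset.range m, ((n + m : ℝ) ^ 2) := by
          refine Finset.prod_le_prod (fun l hl => ?_) fun l hl => ?_
          · have h1 : (l : ℝ) + 1 ≤ (n + m : ℕ) := by
              exact_mod_cast (Finset.mem_range.1 hl).trans_le (Nat.le_add_left m n)
            have h2 : (0 : ℝ) ≤ l := l.cast_nonneg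
            nlinarith
          · push_cast
            nlinarith [sq_nonneg (l : ℝ)]
      _ = _ := by simp
  refine (div_le_self ?_ ?_).trans h4
  · refine Finset.prod_nonneg fun l hl => ?_
    have h1 : (l : ℝ) + 1 ≤ (n + m : ℕ) := by
      exact_mod_cast (Finset.mem_range.1 hl).trans_le (Nat.le_add_left m n)
    have h2 : (0 : ℝ) ≤ l := l.cast_nonneg
    nlinarith
  · have := pi_gt_three
    nlinarith [one_le_pow₀ h3 (n := 2)]

end Ultra

/-! ### The Fischer inner product and Laplacians of products of powers -/

namespace Fischer

open MvPolynomial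

variable {σ : Type*} [Fintype σ]

/-- The Fischer inner product `p(∂) q` evaluated at `0`. -/
noncomputable def inner (p q : MvPolynomial σ ℝ) : ℝ :=
  ∑ s ∈ p.support, p.coeff s * ((∏ i, (s i).factorial : ℕ) * q.coeff s)

lemma inner_eq_sum {p : MvPolynomial σ ℝ} (q : MvPolynomial σ ℝ) {t : Finset (σ →₀ ℕ)}
    (ht : p.support ⊆ t) :
    inner p q = ∑ s ∈ t, p.coeff s * ((∏ i, (s i).factorial : ℕ) * q.coeff s) := by
  refine Finset.sum_subset ht fun s _ hs => ?_
  rw [notMem_support_iff.1 hs, zero_mul]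

lemma inner_add_left (p p' q : MvPolynomial σ ℝ) :
    inner (p + p') q = inner p q + inner p' q := by
  classical
  rw [inner_eq_sum q (support_add (p := p) (q := p')),
    inner_eq_sum q (Finset.subset_union_left (s₁ := p.support) (s₂ := p'.support)),
    inner_eq_sum q (Finset.subset_union_right (s₁ := p.support) (s₂ := p'.support)),
    ← Finset.sum_add_distrib]
  exact Finset.sum_congr rfl fun _ _ => by rw [coeff_add, add_mul]

lemma inner_monomial_left (s : σ →₀ ℕ) (a : ℝ) (q : MvPolynomial σ ℝ) :
    inner (monomial s a) q = a * ((∏ i, (s i).factorial : ℕ) * q.coeff s) := by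
  classical
  rw [inner_eq_sum q support_monomial_subset, Finset.sum_singleton, coeff_monomial, if_pos rfl]

lemma inner_zero_left (q : MvPolynomial σ ℝ) : inner 0 q = 0 := by simp [inner]

lemma inner_sum_left {ι : Type*} (s : Finset ι) (p : ι → MvPolynomial σ ℝ)
    (q : MvPolynomial σ ℝ) : inner (∑ i ∈ s, p i) q = ∑ i ∈ s, inner (p i) q := by
  classical
  induction s using Finset.induction_on with
  | empty => simp [inner_zero_left]
  | insert a s h ih => rw [Finset.sum_insert h, Finset.sum_insert h, inner_add_left, ih]

lemma inner_C_mul_left (c : ℝ) (p q : MvPolynomial σ ℝ) :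
    inner (C c * p) q = c * inner p q := by
  induction p using MvPolynomial.induction_on' with
  | monomial s a => rw [C_mul_monomial, inner_monomial_left, inner_monomial_left, mul_assoc]
  | add p p' h h' => rw [mul_add, inner_add_left, inner_add_left, h, h', mul_add]

lemma inner_add_right (p q q' : MvPolynomial σ ℝ) :
    inner p (q + q') = inner p q + inner p q' := by
  simp only [inner, coeff_add, mul_add, Finset.sum_add_distrib]

lemma inner_C_mul_right (c : ℝ) (p q : MvPolynomial σ ℝ) :
    inner p (C c * q) = c * inner p q := by
  simp only [inner, coeff_C_mul, Finset.mul_sum]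
  exact Finset.sum_congr rfl fun _ _ => by ring

lemma inner_sum_right {ι : Type*} (s : Finset ι) (p : MvPolynomial σ ℝ)
    (q : ι → MvPolynomial σ ℝ) : inner p (∑ i ∈ s, q i) = ∑ i ∈ s, inner p (q i) := by
  classical
  induction s using Finset.induction_on with
  | empty => simp [inner]
  | insert a s h ih => rw [Finset.sum_insert h, Finset.sum_insert h, inner_add_right, ih]

lemma inner_self_nonneg (p : MvPolynomial σ ℝ) : 0 ≤ inner p p := by
  refine Finset.sum_nonneg fun s _ => ?_
  have : (0 : ℝ) ≤ (∏ i, (s i).factorial : ℕ) := Nat.cast_nonneg _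
  nlinarith [mul_self_nonneg (p.coeff s)]

/-- The factorial weights are made for this: raising the exponent of `X i` multiplies the weight by
`s i + 1`, the factor produced by differentiation. Consequently `normSq` is adjoint to the Laplacian
and a linear form to a directional derivative. -/
lemma inner_X_mul (i : σ) (p q : MvPolynomial σ ℝ) :
    inner (X i * p) q = inner p (pderiv i q) := by
  induction p using MvPolynomial.induction_on' with
  | monomial s a =>
    have h : (X i * monomial s a : MvPolynomial σ ℝ) = monomial (Finsupp.single i 1 + s) a := by
      rw [monomial_single_add, pow_one]
    rw [h, inner_monomial_left, inner_monomial_left, coeff_pderiv, add_comm s]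
    classical
    have h2 : ∏ k, ((Finsupp.single i 1 + s : σ →₀ ℕ) k).factorial = (s i + 1) * ∏ k, (s k).factorial := by
      rw [← Finset.mul_prod_erase _ _ (Finset.mem_univ i),
        ← Finset.mul_prod_erase Finset.univ (fun k => (s k).factorial) (Finset.mem_univ i),
        ← mul_assoc]
      congr 1
      · simp [add_comm 1, Nat.factorial_succ]
      · refine Finset.prod_congr rfl fun k hk => ?_
        simp [(Finset.ne_of_mem_erase hk).symm]
    rw [h2]
    push_cast
    ring
  | add p p' h h' => rw [mul_add, inner_add_left, inner_add_left, h, h']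

/-- The linear form with coefficients `x`. -/
noncomputable def linForm (x : σ → ℝ) : MvPolynomial σ ℝ := ∑ i, C (x i) * X i

/-- The squared Euclidean norm. -/
noncomputable def normSq (σ : Type*) [Fintype σ] : MvPolynomial σ ℝ := ∑ i, X i ^ 2

lemma inner_normSq_mul (p q : MvPolynomial σ ℝ) :
    inner (normSq σ * p) q = inner p (∑ i, pderiv i (pderiv i q)) := by
  rw [normSq, Finset.sum_mul, inner_sum_left, inner_sum_right]
  refine Finset.sum_congr rfl fun i _ => ?_
  rw [sq, mul_assoc, inner_X_mul, inner_X_mul]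

lemma inner_linForm_mul (x : σ → ℝ) (p q : MvPolynomial σ ℝ) :
    inner (linForm x * p) q = inner p (∑ i, C (x i) * pderiv i q) := by
  rw [linForm, Finset.sum_mul, inner_sum_left, inner_sum_right]
  refine Finset.sum_congr rfl fun i _ => ?_
  rw [mul_assoc, inner_C_mul_left, inner_X_mul, inner_C_mul_right]

/-- Move the linear forms across one at a time. By Euler's identity, differentiating along `x` and
evaluating at `x` multiplies by the degree, which builds the factorial. -/
lemma inner_linForm_pow (x : σ → ℝ) (n : ℕ) (q : MvPolynomial σ ℝ) (hq : q.IsHomogeneous n) :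
    inner (linForm x ^ n) q = n.factorial * eval x q := by
  induction n generalizing q with
  | zero =>
    rw [← totalDegree_zero_iff_isHomogeneous, totalDegree_eq_zero_iff_eq_C] at hq
    rw [hq, pow_zero, ← C_1, ← monomial_zero', inner_monomial_left]
    simp
  | succ n ih =>
    have hd : (∑ i, C (x i) * pderiv i q).IsHomogeneous n := by
      refine IsHomogeneous.sum _ _ _ fun i _ => ?_
      have := (isHomogeneous_C σ (x i)).mul (hq.pderiv (i := i))
      simpa using this
    rw [pow_succ', inner_linForm_mul, ih _ hd, Nat.factorial_succ]
    have h := congr_arg (eval x) hq.sum_X_mul_pderiv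
    simp only [map_sum, map_mul, eval_X, eval_C, nsmul_eq_mul, map_natCast] at h ⊢
    rw [h]
    push_cast
    ring

lemma pderiv_linForm (x : σ → ℝ) (i : σ) : pderiv i (linForm x) = C (x i) := by
  classical
  simp [linForm, pderiv_X, Pi.single_apply]

lemma pderiv_normSq (i : σ) : pderiv i (normSq σ) = C 2 * X i := by
  classical
  simp [normSq, pderiv_X, Pi.single_apply, map_ofNat]

lemma sum_C_mul_self {x : σ → ℝ} (hx : ∑ i, x i ^ 2 = 1) :
    ∑ i, (C (x i) * C (x i) : MvPolynomial σ ℝ) = 1 := by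
  simp_rw [← C_mul, ← map_sum, ← sq, hx, C_1]

lemma laplacian_mul (p q : MvPolynomial σ ℝ) :
    ∑ i, pderiv i (pderiv i (p * q)) = (∑ i, pderiv i (pderiv i p)) * q +
      2 * ∑ i, pderiv i p * pderiv i q + p * ∑ i, pderiv i (pderiv i q) := by
  rw [Finset.sum_mul, Finset.mul_sum, Finset.mul_sum, ← Finset.sum_add_distrib,
    ← Finset.sum_add_distrib]
  refine Finset.sum_congr rfl fun i _ => ?_
  simp only [pderiv_mul, map_add]
  ring

lemma laplacian_linForm_pow (x : σ → ℝ) (hx : ∑ i, x i ^ 2 = 1) (j : ℕ) :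
    ∑ i, pderiv i (pderiv i (linForm x ^ j)) =
      C (j * (j - 1) : ℝ) * linForm x ^ (j - 2) := by
  have h : ∀ i, pderiv i (pderiv i (linForm x ^ j)) =
      C (j * (j - 1) : ℝ) * linForm x ^ (j - 2) * (C (x i) * C (x i)) := by
    intro i
    rcases j with _ | _ | j
    · simp
    · simp [pderiv_linForm]
    · simp only [pderiv_pow, pderiv_mul, pderiv_linForm, pderiv_C, Nat.add_sub_cancel,
        Derivation.map_natCast]
      simp only [C_add, C_mul, C_sub, C_1, map_natCast, Nat.cast_add, Nat.cast_one,
        show j + 1 + 1 - 2 = j by omega]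
      ring
  simp_rw [h]
  rw [← Finset.mul_sum, sum_C_mul_self hx, mul_one]

lemma laplacian_normSq_pow (k : ℕ) :
    ∑ i, pderiv i (pderiv i (normSq σ ^ k)) =
      C (2 * k * (2 * k + Fintype.card σ - 2) : ℝ) * normSq σ ^ (k - 1) := by
  have h : ∀ i, pderiv i (pderiv i (normSq σ ^ k)) =
      C (2 * k : ℝ) * normSq σ ^ (k - 1) +
        C (4 * k * (k - 1) : ℝ) * normSq σ ^ (k - 2) * X i ^ 2 := by
    intro i
    -- The truncated exponents `k - 1` and `k - 2` differ from the true ones only where their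
    -- coefficients vanish.
    rcases k with _ | _ | k
    · simp
    · simp [pderiv_normSq]
    · simp only [pderiv_pow, pderiv_mul, pderiv_normSq, pderiv_C, Nat.add_sub_cancel,
        Derivation.map_natCast, pderiv_X_self]
      simp only [C_add, C_mul, C_sub, C_1, map_natCast, Nat.cast_add, Nat.cast_one,
        show k + 1 + 1 - 2 = k by omega, map_ofNat]
      ring
  simp_rw [h]
  have hR : ∑ i, (X i : MvPolynomial σ ℝ) ^ 2 = normSq σ := rfl
  rw [Finset.sum_add_distrib, Finset.sum_const, Finset.card_univ,
    nsmul_eq_mul, ← Finset.mul_sum, hR]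
  rcases k with _ | _ | k
  · simp
  · simp
    ring
  · simp only [C_add, C_mul, C_sub, C_1, map_natCast, Nat.cast_add, Nat.cast_one,
        show k + 1 + 1 - 2 = k by omega, map_ofNat, Nat.add_sub_cancel]
    ring

lemma sum_pderiv_linForm_pow_mul_pderiv_normSq_pow (x : σ → ℝ) (j k : ℕ) :
    ∑ i, pderiv i (linForm x ^ j) * pderiv i (normSq σ ^ k) =
      C (2 * j * k : ℝ) * (linForm x ^ j * normSq σ ^ (k - 1)) := by
  have h : ∀ i, pderiv i (linForm x ^ j) * pderiv i (normSq σ ^ k) =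
      C (2 * j * k : ℝ) * (linForm x ^ (j - 1) * normSq σ ^ (k - 1)) * (C (x i) * X i) := by
    intro i
    simp only [pderiv_pow, pderiv_linForm, pderiv_normSq, C_mul, map_natCast, map_ofNat]
    ring
  simp_rw [h]
  have hL : ∑ i, C (x i) * X i = linForm x := rfl
  rw [← Finset.mul_sum, hL]
  rcases j with _ | j
  · simp
  · simp only [Nat.add_sub_cancel]
    ring

lemma laplacian_linForm_pow_mul (x : σ → ℝ) (hx : ∑ i, x i ^ 2 = 1) (j k : ℕ) :
    ∑ i, pderiv i (pderiv i (linForm x ^ j * normSq σ ^ k)) =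
      C (j * (j - 1) : ℝ) * (linForm x ^ (j - 2) * normSq σ ^ k) +
      C (2 * k * (2 * j + 2 * k + Fintype.card σ - 2) : ℝ) *
        (linForm x ^ j * normSq σ ^ (k - 1)) := by
  rw [laplacian_mul, laplacian_linForm_pow x hx, laplacian_normSq_pow,
    sum_pderiv_linForm_pow_mul_pderiv_normSq_pow]
  simp only [C_add, C_mul, C_sub, C_1, map_natCast, map_ofNat]
  ring

end Fischer

/-! ### Coefficient recurrence and zonal harmonics -/

lemma UltraODE.coeff {m n : ℕ} {q : Polynomial ℝ} (hq : UltraODE m n q) (j : ℕ) :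
    (j + 2 : ℝ) * (j + 1) * q.coeff (j + 2) + (n - j) * (n + 2 * m + j) * q.coeff j = 0 := by
  have h := congr_arg (fun p => p.coeff j) hq
  simp only [sub_mul, one_mul, mul_assoc, Polynomial.coeff_sub, Polynomial.coeff_C_mul,
    Polynomial.coeff_derivative] at h
  rcases j with _ | _ | j
  · simp at h ⊢
    linarith
  · simp [Polynomial.coeff_X_pow_mul', Polynomial.coeff_X_mul, Polynomial.coeff_derivative] at h ⊢
    norm_num at h
    linarith
  · rw [Polynomial.coeff_X_pow_mul] at h
    simp [Polynomial.coeff_X_mul, Polynomial.coeff_derivative] at h ⊢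
    linarith

/-- Parity: the recurrence has step two, starts from the zero coefficient of degree `n + 1`, and the
factor `(n - j)(n + 2m + j)` is nonzero below `n`. -/
lemma UltraODE.coeff_eq_zero {m n : ℕ} {q : Polynomial ℝ} (hq : UltraODE m n q)
    (hn : q.natDegree ≤ n) (i j : ℕ) (hj : j + (2 * i + 1) = n) : q.coeff j = 0 := by
  induction i generalizing j with
  | zero =>
    have h := hq.coeff j
    rw [Polynomial.coeff_eq_zero_of_natDegree_lt (n := j + 2) (by omega)] at h
    subst hj
    simp at h
    rcases h with h | h
    · exfalso; revert h; positivity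
    · exact h
  | succ i ih =>
    have h := hq.coeff j
    rw [ih (j + 2) (by omega)] at h
    subst hj
    simp at h
    rcases h with (h | h) | h
    · exfalso; revert h; positivity
    · exfalso; revert h; positivity
    · exact h

namespace Fischer

open MvPolynomial

variable {σ : Type*} [Fintype σ]

/-- The homogeneous extension of degree `n` of the zonal function `y ↦ q ⟨x, y⟩`. -/
noncomputable def zonal (n : ℕ) (q : Polynomial ℝ) (x : σ → ℝ) : MvPolynomial σ ℝ :=
  -- Two vanishing top terms are included so that the shift by two in `laplacian_zonal` leaves sums
  -- over equal ranges. The rounding in `(n - j) / 2` affects only zero coefficients.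
  ∑ j ∈ Finset.range (n + 3), C (q.coeff j) * (linForm x ^ j * normSq σ ^ ((n - j) / 2))

lemma isHomogeneous_linForm (x : σ → ℝ) : (linForm x).IsHomogeneous 1 :=
  IsHomogeneous.sum _ _ _ fun i _ => by
    simpa using (isHomogeneous_C σ (x i)).mul (isHomogeneous_X ℝ i)

lemma isHomogeneous_normSq : (normSq σ).IsHomogeneous 2 :=
  IsHomogeneous.sum _ _ _ fun i _ => isHomogeneous_X_pow i 2

lemma eval_linForm (x y : σ → ℝ) : eval y (linForm x) = ∑ i, x i * y i := by simp [linForm]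

lemma eval_normSq (y : σ → ℝ) : eval y (normSq σ) = ∑ i, y i ^ 2 := by simp [normSq]

lemma eval_zonal {n : ℕ} {q : Polynomial ℝ} (hn : q.natDegree ≤ n) (x y : σ → ℝ)
    (hy : ∑ i, y i ^ 2 = 1) : eval y (zonal n q x) = q.eval (∑ i, x i * y i) := by
  rw [zonal, Polynomial.eval_eq_sum_range' (n := n + 3) (by omega)]
  simp [eval_linForm, eval_normSq, hy]

lemma isHomogeneous_zonal {m n : ℕ} {q : Polynomial ℝ} (hq : UltraODE m n q)
    (hn : q.natDegree ≤ n) (x : σ → ℝ) : (zonal n q x).IsHomogeneous n := by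
  refine IsHomogeneous.sum _ _ _ fun j _ => ?_
  by_cases h0 : q.coeff j = 0
  · rw [h0, C_0, zero_mul]
    exact isHomogeneous_zero _ _ _
  have hj : j ≤ n := by
    by_contra h
    exact h0 (Polynomial.coeff_eq_zero_of_natDegree_lt (by omega))
  have h2 : j + 2 * ((n - j) / 2) = n := by
    by_contra h
    exact h0 (hq.coeff_eq_zero hn ((n - j) / 2) j (by omega))
  have := (isHomogeneous_C σ (q.coeff j)).mul
    (((isHomogeneous_linForm x).pow j).mul ((isHomogeneous_normSq (σ := σ)).pow ((n - j) / 2)))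
  rwa [zero_add, one_mul, h2] at this

/-- In dimension `2m + 2`, the coefficients of the Laplacian are `(j+2)(j+1) q_{j+2} + (n-j)(n+2m+j)
q_j`, exactly the recurrence `UltraODE.coeff`. -/
lemma laplacian_zonal {m n : ℕ} {q : Polynomial ℝ} (hq : UltraODE m n q)
    (hn : q.natDegree ≤ n) (hσ : Fintype.card σ = 2 * m + 2) (x : σ → ℝ)
    (hx : ∑ i, x i ^ 2 = 1) : ∑ i, pderiv i (pderiv i (zonal n q x)) = 0 := by
  have h0 : ∀ j, n < j → q.coeff j = 0 := fun j hj =>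
    Polynomial.coeff_eq_zero_of_natDegree_lt (by omega)
  have h1 : ∑ i, pderiv i (pderiv i (zonal n q x)) = ∑ j ∈ Finset.range (n + 3),
      (C (q.coeff j * (j * (j - 1)) : ℝ) * (linForm x ^ (j - 2) * normSq σ ^ ((n - j) / 2)) +
      C (q.coeff j * (2 * ((n - j) / 2 : ℕ) * (2 * j + 2 * ((n - j) / 2 : ℕ) + 2 * m)) : ℝ) *
        (linForm x ^ j * normSq σ ^ ((n - j) / 2 - 1))) := by
    simp only [zonal, map_sum, pderiv_C_mul]
    rw [Finset.sum_comm]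
    refine Finset.sum_congr rfl fun j _ => ?_
    rw [← Finset.mul_sum, laplacian_linForm_pow_mul x hx, hσ, mul_add,
      ← mul_assoc (C _) (C _), ← C_mul, ← mul_assoc (C _) (C _), ← C_mul]
    congr 4
    push_cast
    ring
  rw [h1, Finset.sum_add_distrib, Finset.sum_range_succ', Finset.sum_range_succ',
    Finset.sum_range_succ (n := n + 2), Finset.sum_range_succ (n := n + 1),
    h0 (n + 1) (by omega), h0 (n + 2) (by omega)]
  simp only [zero_mul, C_0, add_zero, Nat.cast_zero, mul_zero, zero_add, Nat.cast_one, sub_self]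
  rw [← Finset.sum_add_distrib]
  refine Finset.sum_eq_zero fun j hj => ?_
  have hj' : j ≤ n := by simpa [Nat.lt_succ_iff] using hj
  have hc := hq.coeff j
  by_cases hqj : q.coeff j = 0
  · have : q.coeff (j + 2) = 0 := by
      rw [hqj, mul_zero, add_zero] at hc
      exact (mul_eq_zero.1 hc).resolve_left (by positivity)
    simp [this, hqj]
  have h2 : j + 2 * ((n - j) / 2) = n := by
    by_contra h
    exact hqj (hq.coeff_eq_zero hn ((n - j) / 2) j (by omega))
  have e1 : (n - (j + 1 + 1)) / 2 = (n - j) / 2 - 1 := by omega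
  have e2 : j + 1 + 1 - 2 = j := by omega
  rw [e1, e2, ← add_mul, ← C_add]
  have h3 : ((2 * ((n - j) / 2 : ℕ) : ℝ)) = n - j := by
    rw [eq_sub_iff_add_eq]
    exact_mod_cast (by omega : 2 * ((n - j) / 2) + j = n)
  have : q.coeff (j + 1 + 1) * (((j + 1 + 1 : ℕ) : ℝ) * (((j + 1 + 1 : ℕ) : ℝ) - 1)) +
      q.coeff j * (2 * ((n - j) / 2 : ℕ) * (2 * j + 2 * ((n - j) / 2 : ℕ) + 2 * m)) = 0 := by
    rw [h3]
    push_cast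
    linear_combination hc
  rw [this, C_0, zero_mul]

/-- The second argument is harmonic, so every term of the first with a factor `normSq` pairs to
zero. Only the top power of the linear form survives, and pairing with it is evaluation. -/
lemma inner_zonal {m n : ℕ} {q : Polynomial ℝ} (hq : UltraODE m n q)
    (hn : q.natDegree ≤ n) (hσ : Fintype.card σ = 2 * m + 2) (x y : σ → ℝ)
    (hy : ∑ i, y i ^ 2 = 1) (hx : ∑ i, x i ^ 2 = 1) :
    inner (zonal n q x) (zonal n q y) = q.coeff n * n.factorial * q.eval (∑ i, x i * y i) := by
  have h1 : inner (zonal n q x) (zonal n q y) =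
      q.coeff n * inner (linForm x ^ n) (zonal n q y) := by
    conv_lhs => rw [zonal]
    rw [inner_sum_left, Finset.sum_eq_single n]
    · simp [inner_C_mul_left]
    · intro j _ hjn
      rw [inner_C_mul_left]
      by_cases hqj : q.coeff j = 0
      · rw [hqj, zero_mul]
      have hj : j ≤ n := by
        by_contra h
        exact hqj (Polynomial.coeff_eq_zero_of_natDegree_lt (by omega))
      obtain ⟨k, hk⟩ : ∃ k, (n - j) / 2 = k + 1 := by
        refine Nat.exists_eq_succ_of_ne_zero fun h => ?_
        exact hqj (hq.coeff_eq_zero hn 0 j (by omega))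
      rw [hk, pow_succ', mul_left_comm, inner_normSq_mul, laplacian_zonal hq hn hσ y hy]
      simp [inner]
    · intro h
      exact absurd (Finset.mem_range.2 (by omega)) h
  rw [h1, inner_linForm_pow _ _ _ (isHomogeneous_zonal hq hn y), eval_zonal hn _ _ hx]
  simp only [mul_comm (y _), mul_assoc]

/-- Ultraspherical polynomials are positive definite on the sphere. -/
lemma sum_mul_eval_nonneg {m n : ℕ} {q : Polynomial ℝ} (hq : UltraODE m n q)
    (hn : q.natDegree ≤ n) (hpos : 0 < q.coeff n) (hσ : Fintype.card σ = 2 * m + 2)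
    {ι : Type*} [Fintype ι] (x : ι → σ → ℝ) (hx : ∀ a, ∑ i, x a i ^ 2 = 1) (c : ι → ℝ) :
    0 ≤ ∑ a, ∑ b, c a * c b * q.eval (∑ i, x a i * x b i) := by
  -- Up to the positive factor `q_n · n!`, the double sum is the Fischer square of this combination
  -- of zonal harmonics.
  have h := inner_self_nonneg (∑ a, C (c a) * zonal n q (x a))
  rw [inner_sum_left] at h
  simp_rw [inner_sum_right, inner_C_mul_left, inner_C_mul_right,
    inner_zonal hq hn hσ _ _ (hx _) (hx _)] at h
  have h2 : 0 < q.coeff n * n.factorial := by positivity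
  refine (mul_nonneg_iff_of_pos_left h2).1 ?_
  rw [Finset.mul_sum]
  refine h.trans_eq (Finset.sum_congr rfl fun _ _ => ?_)
  rw [Finset.mul_sum]
  exact Finset.sum_congr rfl fun _ _ => by ring

end Fischer

/-! ### Repeated integrals and positivity of the coefficients -/

namespace Ultra

open Polynomial Real MeasureTheory

/-- The primitive vanishing at `0`. -/
noncomputable def primitive (f : ℝ → ℝ) (t : ℝ) : ℝ := ∫ s in (0)..t, f s

lemma hasDerivAt_primitive {f : ℝ → ℝ} (hf : Continuous f) (t : ℝ) :
    HasDerivAt (primitive f) (f t) t :=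
  hf.integral_hasStrictDerivAt 0 t |>.hasDerivAt

lemma continuous_primitive {f : ℝ → ℝ} (hf : Continuous f) : Continuous (primitive f) :=
  continuous_iff_continuousAt.2 fun t => (hasDerivAt_primitive hf t).continuousAt

lemma primitive_zero (f : ℝ → ℝ) : primitive f 0 = 0 := intervalIntegral.integral_same

lemma continuous_iterate_primitive {f : ℝ → ℝ} (hf : Continuous f) (k : ℕ) :
    Continuous (primitive^[k] f) := by
  induction k with
  | zero => exact hf
  | succ k ih => rw [Function.iterate_succ_apply']; exact continuous_primitive ih

lemma primitive_eq_of_hasDerivAt {f F : ℝ → ℝ} (hf : Continuous f)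
    (hF : ∀ t, HasDerivAt F (f t) t) (h0 : F 0 = 0) : primitive f = F := by
  ext t
  rw [primitive, intervalIntegral.integral_eq_sub_of_hasDerivAt (fun s _ => hF s)
    (hf.intervalIntegrable _ _), h0, sub_zero]

lemma iterate_primitive_linear {f g : ℝ → ℝ} (hf : Continuous f) (hg : Continuous g) (a b : ℝ)
    (k : ℕ) : primitive^[k] (fun t => a * f t + b * g t) =
      fun t => a * primitive^[k] f t + b * primitive^[k] g t := by
  induction k with
  | zero => rfl
  | succ k ih =>
    simp only [Function.iterate_succ_apply', ih]
    have h1 := continuous_iterate_primitive hf k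
    have h2 := continuous_iterate_primitive hg k
    refine primitive_eq_of_hasDerivAt (by fun_prop) (fun t => ?_) (by simp [primitive_zero])
    exact ((hasDerivAt_primitive h1 t).const_mul a).add ((hasDerivAt_primitive h2 t).const_mul b)

/-- Cauchy's formula for repeated integration. -/
lemma iterate_primitive_eq {f : ℝ → ℝ} (hf : Continuous f) (k : ℕ) (t : ℝ) :
    primitive^[k + 1] f t = ∫ s in (0)..t, (t - s) ^ k / k.factorial * f s := by
  induction k generalizing f with
  | zero => simp [primitive]
  | succ k ih =>
    rw [Function.iterate_succ_apply, ih (continuous_primitive hf)]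
    have hp := continuous_primitive hf
    have hd : ∀ s ∈ Set.uIcc 0 t, HasDerivAt
        (fun s => (t - s) ^ (k + 1) / (k + 1).factorial * primitive f s)
        ((t - s) ^ (k + 1) / (k + 1).factorial * f s -
          (t - s) ^ k / k.factorial * primitive f s) s := by
      intro s _
      have h := ((((hasDerivAt_id s).const_sub t).pow (k + 1)).div_const
        ((k + 1).factorial : ℝ)).mul (hasDerivAt_primitive hf s)
      refine h.congr_deriv ?_
      have h2 : (k.factorial : ℝ) ≠ 0 := by positivity
      simp only [Nat.factorial_succ, id, Pi.pow_apply, Nat.add_sub_cancel]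
      push_cast
      field_simp
      ring
    have h := intervalIntegral.integral_eq_sub_of_hasDerivAt hd
      (Continuous.intervalIntegrable (by fun_prop) _ _)
    rw [intervalIntegral.integral_sub (Continuous.intervalIntegrable (by fun_prop) _ _)
      (Continuous.intervalIntegrable (by fun_prop) _ _)] at h
    simp [primitive_zero] at h
    linarith

/-- The ultraspherical polynomial times its weight. -/
noncomputable def weighted (m n : ℕ) (θ : ℝ) : ℝ := (ultra m n).eval (cos θ) * sin θ ^ (2 * m)

lemma continuous_weighted (m n : ℕ) : Continuous (weighted m n) :=
  (continuous_eval_cos _).mul (continuous_sin.pow _)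

/-- The derivative of `weighted`. -/
noncomputable def weightedDeriv (m n : ℕ) (θ : ℝ) : ℝ :=
  -- For `m = 0` the truncated exponent is harmless, since its coefficient is zero.
  2 * m * sin θ ^ (2 * m - 1) * cos θ * (ultra m n).eval (cos θ) -
    sin θ ^ (2 * m + 1) * (derivative (ultra m n)).eval (cos θ)

lemma continuous_weightedDeriv (m n : ℕ) : Continuous (weightedDeriv m n) := by
  have h1 := continuous_eval_cos (ultra m n)
  have h2 := continuous_eval_cos (derivative (ultra m n))
  unfold weightedDeriv
  fun_prop

lemma hasDerivAt_weighted (m n : ℕ) (θ : ℝ) :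
    HasDerivAt (weighted m n) (weightedDeriv m n θ) θ := by
  refine ((hasDerivAt_eval_cos (ultra m n) θ).mul ((hasDerivAt_sin θ).pow (2 * m))).congr_deriv ?_
  simp only [weightedDeriv, Pi.pow_apply]
  push_cast
  ring

/-- The differential equation eliminates the second derivative of the polynomial, and `lowering`
identifies the remainder that carries only `sin^(2m)`. -/
lemma hasDerivAt_weightedDeriv (m n : ℕ) (θ : ℝ) :
    HasDerivAt (weightedDeriv (m + 1) n)
      ((2 * (m + 1) * (2 * m + 1)) * weighted m n θ +
        (-(n + 2 * (m + 1)) ^ 2 : ℝ) * weighted (m + 1) n θ) θ := by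
  have h := (((((hasDerivAt_sin θ).pow (2 * m + 1)).const_mul (2 * (m + 1) : ℝ)).mul
    (hasDerivAt_cos θ)).mul (hasDerivAt_eval_cos (ultra (m + 1) n) θ)).sub
    (((hasDerivAt_sin θ).pow (2 * m + 3)).mul
      (hasDerivAt_eval_cos (derivative (ultra (m + 1) n)) θ))
  have e : weightedDeriv (m + 1) n = fun θ =>
      2 * (m + 1 : ℝ) * sin θ ^ (2 * m + 1) * cos θ * (ultra (m + 1) n).eval (cos θ) -
      sin θ ^ (2 * m + 3) * (derivative (ultra (m + 1) n)).eval (cos θ) := by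
    ext θ
    simp [weightedDeriv, show 2 * (m + 1) - 1 = 2 * m + 1 by omega,
      show 2 * (m + 1) + 1 = 2 * m + 3 by omega]
  rw [e]
  refine h.congr_deriv ?_
  have h1 := congr_arg (eval (cos θ)) (ode (m + 1) n)
  have h2 := congr_arg (eval (cos θ)) (lowering m n)
  simp only [eval_mul, eval_sub, eval_add, Polynomial.eval_one, eval_pow, eval_X, eval_C] at h1 h2
  rw [← sin_sq] at h1 h2
  simp only [weighted, Pi.mul_apply, Pi.pow_apply]
  simp only [show 2 * m + 1 - 1 = 2 * m by omega, show 2 * m + 3 - 1 = 2 * m + 2 by omega,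
    show 2 * (m + 1) = 2 * m + 2 by omega]
  push_cast at h1 h2 ⊢
  simp only [pow_add]
  linear_combination (sin θ ^ (2 * m) * sin θ ^ 2) * h1 +
    2 * (m + 1) * sin θ ^ (2 * m) * h2

/-- The transform `∫₀ᵗ (t - θ)^(m+1) / (m+1)! · P(cos θ) sin^(2m) θ dθ`. -/
noncomputable def truncCoeff (m n : ℕ) : ℝ → ℝ := primitive^[m + 2] (weighted m n)

lemma continuous_truncCoeff (m n : ℕ) : Continuous (truncCoeff m n) :=
  continuous_iterate_primitive (continuous_weighted m n) _

/-- Integrate the formula for the second derivative of `weighted (m + 1) n` a total of `m + 2`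
times; that function and its derivative vanish at `0`, so no boundary terms arise. -/
lemma truncCoeff_relation (m n : ℕ) (t : ℝ) :
    (2 * (m + 1) * (2 * m + 1)) * truncCoeff m n t =
      primitive^[m] (weighted (m + 1) n) t +
        (n + 2 * (m + 1)) ^ 2 * primitive^[m + 2] (weighted (m + 1) n) t := by
  have hw0 := continuous_weighted m n
  have hw1 := continuous_weighted (m + 1) n
  have h1 : primitive (fun θ => (2 * (m + 1) * (2 * m + 1)) * weighted m n θ +
      (-(n + 2 * (m + 1)) ^ 2 : ℝ) * weighted (m + 1) n θ) = weightedDeriv (m + 1) n :=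
    primitive_eq_of_hasDerivAt (by fun_prop) (hasDerivAt_weightedDeriv m n)
      (by simp [weightedDeriv, show 2 * (m + 1) - 1 = 2 * m + 1 by omega])
  have h2 : primitive (weightedDeriv (m + 1) n) = weighted (m + 1) n :=
    primitive_eq_of_hasDerivAt (continuous_weightedDeriv _ _) (hasDerivAt_weighted _ _)
      (by simp [weighted])
  have h3 := iterate_primitive_linear hw0 hw1 (2 * (m + 1) * (2 * m + 1))
    (-(n + 2 * (m + 1)) ^ 2 : ℝ) (m + 2)
  rw [Function.iterate_add_apply, Function.iterate_succ_apply, Function.iterate_one, h1, h2] at h3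
  have h4 := congr_fun h3 t
  rw [truncCoeff, h4]
  ring

/-- By `truncCoeff_relation`, `y = truncCoeff (m + 1) n` solves `y''' + ν² y' = f` with `y`, `y'`,
`y''` zero at `0`, where `f` is a positive multiple of `truncCoeff m n`. This is variation of
constants; its nonnegative kernel drives the induction on `m`. -/
lemma truncCoeff_succ (m n : ℕ) (t : ℝ) :
    truncCoeff (m + 1) n t = ∫ s in (0)..t, (1 - cos ((n + 2 * (m + 1)) * (t - s))) /
      (n + 2 * (m + 1)) ^ 2 * ((2 * (m + 1) * (2 * m + 1)) * truncCoeff m n s) := by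
  set ν : ℝ := n + 2 * (m + 1) with hν
  have hν0 : ν ≠ 0 := by positivity
  have hc := continuous_weighted (m + 1) n
  have hy : ∀ k s, HasDerivAt (primitive^[k + 1] (weighted (m + 1) n))
      (primitive^[k] (weighted (m + 1) n) s) s := by
    intro k s
    rw [Function.iterate_succ_apply']
    exact hasDerivAt_primitive (continuous_iterate_primitive hc k) s
  have hd : ∀ s ∈ Set.uIcc 0 t, HasDerivAt
      (fun s => (1 - cos (ν * (t - s))) / ν ^ 2 * primitive^[m + 1] (weighted (m + 1) n) s +
        sin (ν * (t - s)) / ν * primitive^[m + 2] (weighted (m + 1) n) s +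
        primitive^[m + 3] (weighted (m + 1) n) s)
      ((1 - cos (ν * (t - s))) / ν ^ 2 * ((2 * (m + 1) * (2 * m + 1)) * truncCoeff m n s)) s := by
    intro s _
    have hl : HasDerivAt (fun s => ν * (t - s)) (ν * (-1)) s :=
      ((hasDerivAt_id s).const_sub t).const_mul ν
    have h := (((((hl.cos.const_sub 1).div_const (ν ^ 2)).mul (hy m s))).add
      ((hl.sin.div_const ν).mul (hy (m + 1) s))).add (hy (m + 2) s)
    refine h.congr_deriv ?_
    rw [truncCoeff_relation m n s]
    simp only [← hν]
    field_simp
    ring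
  have hc' := continuous_truncCoeff m n
  rw [intervalIntegral.integral_eq_sub_of_hasDerivAt hd
    (Continuous.intervalIntegrable (by fun_prop) _ _)]
  have h0 : ∀ k, primitive^[k + 1] (weighted (m + 1) n) 0 = 0 := fun k => by
    rw [Function.iterate_succ_apply', primitive_zero]
  simp [h0, truncCoeff]

lemma weighted_zero_left (n : ℕ) (θ : ℝ) : weighted 0 n θ = cos (n * θ) := by
  simp [weighted, ultra, Chebyshev.T_real_cos]

lemma truncCoeff_zero_zero (t : ℝ) : truncCoeff 0 0 t = t ^ 2 / 2 := by
  have h : weighted 0 0 = fun _ => 1 := by ext θ; simp [weighted_zero_left]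
  have h1 : primitive (weighted 0 0) = fun t => t := by
    rw [h]
    exact primitive_eq_of_hasDerivAt (by fun_prop) (fun t => hasDerivAt_id t) rfl
  have h2 : primitive (fun t : ℝ => t) = fun t => t ^ 2 / 2 := by
    refine primitive_eq_of_hasDerivAt (by fun_prop) (fun t => ?_) (by simp)
    exact (((hasDerivAt_id t).pow 2).div_const 2).congr_deriv (by simp)
  rw [truncCoeff, Function.iterate_succ_apply, Function.iterate_one, h1, h2]

lemma truncCoeff_zero {n : ℕ} (hn : 1 ≤ n) (t : ℝ) :
    truncCoeff 0 n t = (1 - cos (n * t)) / n ^ 2 := by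
  have hn0 : (n : ℝ) ≠ 0 := by positivity
  have h : weighted 0 n = fun θ => cos (n * θ) := by ext θ; simp [weighted_zero_left]
  have hl : ∀ t : ℝ, HasDerivAt (fun t : ℝ => n * t) (n * 1) t := fun t =>
    (hasDerivAt_id t).const_mul _
  have h1 : primitive (weighted 0 n) = fun t => sin (n * t) / n := by
    rw [h]
    refine primitive_eq_of_hasDerivAt (by fun_prop) (fun t => ?_) (by simp)
    exact ((hl t).sin.div_const _).congr_deriv (by field_simp)
  have h2 : primitive (fun t : ℝ => sin (n * t) / n) = fun t => (1 - cos (n * t)) / n ^ 2 := by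
    refine primitive_eq_of_hasDerivAt (by fun_prop) (fun t => ?_) (by simp)
    exact (((hl t).cos.const_sub 1).div_const _).congr_deriv (by field_simp)
  rw [truncCoeff, Function.iterate_succ_apply, Function.iterate_one, h1, h2]

lemma one_sub_cos_nonneg (x : ℝ) : 0 ≤ 1 - cos x := sub_nonneg.2 (cos_le_one x)

lemma one_sub_cos_pos {x : ℝ} (h0 : 0 < x) (h1 : x < 2 * π) : 0 < 1 - cos x := by
  have h : cos x = 1 - 2 * sin (x / 2) ^ 2 := by
    rw [← cos_sq_add_sin_sq (x / 2)]
    have := cos_two_mul (x / 2)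
    rw [mul_div_cancel₀ x two_ne_zero] at this
    rw [this]
    have := sin_sq_add_cos_sq (x / 2)
    linarith
  have := sin_pos_of_pos_of_lt_pi (x := x / 2) (by linarith) (by linarith)
  rw [h]
  have := pow_pos this 2
  linarith

lemma truncCoeff_nonneg (m n : ℕ) {t : ℝ} (ht : 0 ≤ t) : 0 ≤ truncCoeff m n t := by
  induction m generalizing t with
  | zero =>
    rcases n.eq_zero_or_pos with rfl | hn
    · rw [truncCoeff_zero_zero]; positivity
    · rw [truncCoeff_zero hn]
      exact div_nonneg (one_sub_cos_nonneg _) (by positivity)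
  | succ m ih =>
    rw [truncCoeff_succ]
    refine intervalIntegral.integral_nonneg ht fun s hs => ?_
    exact mul_nonneg (div_nonneg (one_sub_cos_nonneg _) (by positivity))
      (mul_nonneg (by positivity) (ih hs.1))

lemma truncCoeff_succ_pos_of (m n : ℕ) {t δ : ℝ} (ht : 0 < t) (hδ : 0 < δ)
    (h : ∀ s ∈ Set.Ioo 0 δ, 0 < truncCoeff m n s) : 0 < truncCoeff (m + 1) n t := by
  rw [truncCoeff_succ]
  set ν : ℝ := n + 2 * (m + 1) with hν
  have hν0 : 0 < ν := by positivity
  have hc := continuous_truncCoeff m n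
  have hK : (0 : ℝ) < 2 * (m + 1) * (2 * m + 1) := by positivity
  refine intervalIntegral.integral_pos ht (by fun_prop) (fun s hs => ?_) ?_
  · exact mul_nonneg (div_nonneg (one_sub_cos_nonneg _) (by positivity))
      (mul_nonneg hK.le (truncCoeff_nonneg m n hs.1.le))
  -- The bound `2π / ν` keeps the phases at `a` and `a / 2` less than a period apart, so the kernel
  -- cannot vanish at both.
  obtain ⟨a, ha0, ha⟩ : ∃ a, 0 < a ∧ a < min (min δ t) (2 * π / ν) :=
    exists_between (lt_min (lt_min hδ ht) (by positivity))
  obtain ⟨⟨haδ, hat⟩, haν⟩ := by simpa only [lt_min_iff] using ha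
  rw [lt_div_iff₀ hν0] at haν
  have key : ∃ s ∈ Set.Ioc 0 a, 0 < 1 - cos (ν * (t - s)) := by
    by_contra! hcon
    have e1 : sin (ν * (t - a)) = 0 ∧ cos (ν * (t - a)) = 1 := by
      have h1 : cos (ν * (t - a)) = 1 :=
        le_antisymm (cos_le_one _) (by linarith [hcon a ⟨ha0, le_rfl⟩])
      have := sin_sq_add_cos_sq (ν * (t - a))
      rw [h1] at this
      exact ⟨by nlinarith, h1⟩
    have h2 := hcon (a / 2) ⟨by linarith, by linarith⟩
    have e3 : ν * (t - a / 2) = ν * (t - a) + ν * a / 2 := by ring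
    rw [e3, cos_add, e1.1, e1.2] at h2
    have := one_sub_cos_pos (x := ν * a / 2) (by positivity) (by nlinarith [pi_pos])
    linarith
  obtain ⟨s, hs, hpos⟩ := key
  exact ⟨s, ⟨hs.1.le, hs.2.trans hat.le⟩, mul_pos (div_pos hpos (by positivity))
    (mul_pos hK (h s ⟨hs.1, hs.2.trans_lt haδ⟩))⟩

/-- At index `0` the coefficient `(1 - cos nt) / n²` has zeros, but it is positive near `0`. One
integration against the kernel spreads this positivity to all `t > 0`, so the claim starts at index
`1`. -/
lemma truncCoeff_succ_pos (m n : ℕ) {t : ℝ} (ht : 0 < t) : 0 < truncCoeff (m + 1) n t := by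
  induction m generalizing t with
  | zero =>
    rcases n.eq_zero_or_pos with rfl | hn
    · refine truncCoeff_succ_pos_of 0 0 ht one_pos fun s hs => ?_
      have := hs.1
      rw [truncCoeff_zero_zero]
      positivity
    · have hn' : (0 : ℝ) < n := by exact_mod_cast hn
      refine truncCoeff_succ_pos_of 0 n ht (δ := 2 * π / n) (by positivity) fun s hs => ?_
      rw [truncCoeff_zero hn]
      have h2 := hs.2
      rw [lt_div_iff₀ hn'] at h2
      exact div_pos (one_sub_cos_pos (mul_pos hn' hs.1) (by linarith)) (by positivity)
  | succ m ih => exact truncCoeff_succ_pos_of (m + 1) n ht one_pos fun s hs => ih hs.1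

/-- The base case is at most `2 / n²`, and each use of the kernel gains another factor of order `1 /
n²`. -/
lemma exists_truncCoeff_le (m : ℕ) : ∃ K : ℝ, ∀ n : ℕ, 1 ≤ n → ∀ t ∈ Set.Icc 0 π,
    truncCoeff m n t ≤ K / n ^ (2 * m + 2) := by
  induction m with
  | zero =>
    refine ⟨2, fun n hn t _ => ?_⟩
    rw [truncCoeff_zero hn]
    simp only [mul_zero, zero_add]
    gcongr
    linarith [neg_one_le_cos (n * t)]
  | succ m ih =>
    obtain ⟨K, hK⟩ := ih
    refine ⟨2 * (2 * (m + 1) * (2 * m + 1) * K) * π, fun n hn t ht => ?_⟩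
    have hn' : (0 : ℝ) < n := by exact_mod_cast hn
    rw [truncCoeff_succ]
    have hc := continuous_truncCoeff m n
    have h1 : ∀ s ∈ Set.Icc 0 t, (1 - cos ((n + 2 * (m + 1)) * (t - s))) /
        (n + 2 * (m + 1) : ℝ) ^ 2 * ((2 * (m + 1) * (2 * m + 1)) * truncCoeff m n s) ≤
        2 / (n : ℝ) ^ 2 * ((2 * (m + 1) * (2 * m + 1)) * (K / n ^ (2 * m + 2))) := by
      intro s hs
      have h0 := truncCoeff_nonneg m n hs.1
      have h2 := hK n hn s ⟨hs.1, hs.2.trans ht.2⟩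
      gcongr
      · linarith [neg_one_le_cos ((n + 2 * (m + 1)) * (t - s))]
      · have : (0 : ℝ) ≤ m := m.cast_nonneg
        linarith
    have h0 : 0 ≤ K / n ^ (2 * m + 2) := by
      exact (truncCoeff_nonneg m n le_rfl).trans (hK n hn 0 ⟨le_rfl, pi_pos.le⟩)
    calc _ ≤ ∫ s in (0)..t, 2 / (n : ℝ) ^ 2 *
            ((2 * (m + 1) * (2 * m + 1)) * (K / n ^ (2 * m + 2))) :=
          intervalIntegral.integral_mono_on ht.1
            (Continuous.intervalIntegrable (by fun_prop) _ _) (by simp) h1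
      _ = t * (2 / (n : ℝ) ^ 2 * ((2 * (m + 1) * (2 * m + 1)) * (K / n ^ (2 * m + 2)))) := by
          rw [intervalIntegral.integral_const, sub_zero, smul_eq_mul]
      _ ≤ π * (2 / (n : ℝ) ^ 2 * ((2 * (m + 1) * (2 * m + 1)) * (K / n ^ (2 * m + 2)))) := by
          gcongr
          exact ht.2
      _ = _ := by
          field_simp
          ring

end Ultra

/-! ### Completeness and the expansion of truncated powers -/

namespace Ultra

open Polynomial Real MeasureTheory

/-- The ultraspherical polynomials as a sequence of polynomials of increasing degree. -/
noncomputable def sequence (m : ℕ) : Polynomial.Sequence ℝ where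
  elems' := ultra m
  degree_eq' n := by
    have h : ultra m n ≠ 0 := fun h => by simpa [h] using coeff_self_pos m n
    rw [degree_eq_natDegree h, natDegree_eq]

lemma span_ultra (m : ℕ) : Submodule.span ℝ (Set.range (ultra m)) = ⊤ :=
  (sequence m).span fun i => isUnit_iff_ne_zero.2 (leadingCoeff_ne_zero.2 ((sequence m).ne_zero i))

/-- A linear functional on polynomials vanishing on the ultraspherical polynomials is zero. -/
lemma eq_zero_of_forall_ultra (m : ℕ) (L : ℝ[X] →ₗ[ℝ] ℝ) (h : ∀ n, L (ultra m n) = 0) (p : ℝ[X]) :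
    L p = 0 := by
  have : L = 0 := LinearMap.ext_on_range (span_ultra m) (by simpa using h)
  rw [this, LinearMap.zero_apply]

lemma integral_mul_eval_cos_eq_zero {m : ℕ} {e : ℝ → ℝ} (he : Continuous e)
    (h : ∀ n, ∫ θ in (0)..π, e θ * weighted m n θ = 0) (p : ℝ[X]) :
    ∫ θ in (0)..π, e θ * (p.eval (cos θ) * sin θ ^ (2 * m)) = 0 := by
  have hc : ∀ p : ℝ[X], IntervalIntegrable
      (fun θ => e θ * (p.eval (cos θ) * sin θ ^ (2 * m))) volume 0 π := fun p => by
    have := continuous_eval_cos p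
    exact Continuous.intervalIntegrable (by fun_prop) _ _
  let L : ℝ[X] →ₗ[ℝ] ℝ :=
    { toFun := fun p => ∫ θ in (0)..π, e θ * (p.eval (cos θ) * sin θ ^ (2 * m))
      map_add' := fun p q => by
        rw [← intervalIntegral.integral_add (hc p) (hc q)]
        refine intervalIntegral.integral_congr fun θ _ => ?_
        simp only [eval_add]
        ring
      map_smul' := fun a p => by
        rw [RingHom.id_apply, smul_eq_mul, ← intervalIntegral.integral_const_mul]
        refine intervalIntegral.integral_congr fun θ _ => ?_
        simp only [eval_smul, smul_eq_mul]
        ring }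
  exact eq_zero_of_forall_ultra m L h p

/-- The ultraspherical polynomials in `cos θ` are complete on `[0, π]`. -/
lemma eq_zero_of_integral_eq_zero {m : ℕ} {e : ℝ → ℝ} (he : Continuous e)
    (h : ∀ n, ∫ θ in (0)..π, e θ * weighted m n θ = 0) {θ : ℝ} (hθ : θ ∈ Set.Icc 0 π) :
    e θ = 0 := by
  have hint : ∫ θ in (0)..π, e θ * (e θ * sin θ ^ (2 * m)) ≤ 0 := by
    refine le_of_forall_pos_le_add fun ε hε => ?_
    set B := ∫ θ in (0)..π, |e θ| * sin θ ^ (2 * m) with hB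
    have hB0 : 0 ≤ B := by
      refine intervalIntegral.integral_nonneg pi_pos.le fun θ hθ => ?_
      have := sin_nonneg_of_mem_Icc hθ
      positivity
    -- Weierstrass approximation in the variable `cos θ`: subtracting `p` from one factor `e` leaves
    -- the integral unchanged and makes it at most `ε`.
    obtain ⟨p, hp⟩ := exists_polynomial_near_of_continuousOn (-1) 1 (fun x => e (arccos x))
      (he.comp continuous_arccos).continuousOn (ε / (B + 1)) (by positivity)
    have hpc := continuous_eval_cos p
    have h0 := integral_mul_eval_cos_eq_zero he h p
    have h1 : ∫ θ in (0)..π, e θ * (e θ * sin θ ^ (2 * m)) =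
        ∫ θ in (0)..π, e θ * ((e θ - p.eval (cos θ)) * sin θ ^ (2 * m)) := by
      simp_rw [sub_mul, mul_sub]
      rw [intervalIntegral.integral_sub (Continuous.intervalIntegrable (by fun_prop) _ _)
          (Continuous.intervalIntegrable (by fun_prop) _ _), h0, sub_zero]
    rw [h1, zero_add]
    calc _ ≤ ∫ θ in (0)..π, ε / (B + 1) * (|e θ| * sin θ ^ (2 * m)) := by
          refine intervalIntegral.integral_mono_on pi_pos.le
            (Continuous.intervalIntegrable (by fun_prop) _ _)
            (Continuous.intervalIntegrable (by fun_prop) _ _) fun θ hθ => ?_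
          have hs := sin_nonneg_of_mem_Icc hθ
          have h2 := hp (cos θ) (cos_mem_Icc θ)
          rw [arccos_cos hθ.1 hθ.2, abs_sub_comm] at h2
          calc _ = (e θ * (e θ - p.eval (cos θ))) * sin θ ^ (2 * m) := by ring
            _ ≤ (|e θ| * |e θ - p.eval (cos θ)|) * sin θ ^ (2 * m) := by
                rw [← abs_mul]
                exact mul_le_mul_of_nonneg_right (le_abs_self _) (by positivity)
            _ ≤ (|e θ| * (ε / (B + 1))) * sin θ ^ (2 * m) := by gcongr
            _ = _ := by ring
      _ = ε * (B / (B + 1)) := by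
          rw [intervalIntegral.integral_const_mul, ← hB]
          ring
      _ ≤ ε * 1 := by
          gcongr
          exact (div_le_one (by positivity)).2 (by linarith)
      _ = ε := mul_one ε
  have hIoo : ∀ θ ∈ Set.Ioo 0 π, e θ = 0 := by
    intro θ hθ
    by_contra hne
    refine hint.not_gt (intervalIntegral.integral_pos pi_pos (by fun_prop) (fun s hs => ?_)
      ⟨θ, Set.Ioo_subset_Icc_self hθ, ?_⟩)
    · have := sin_nonneg_of_mem_Icc (Set.Ioc_subset_Icc_self hs)
      rw [← mul_assoc]
      exact mul_nonneg (mul_self_nonneg _) (by positivity)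
    · have := sin_pos_of_mem_Ioo hθ
      rw [← mul_assoc]
      exact mul_pos (mul_self_pos.2 hne) (by positivity)
  have hcl : IsClosed {θ | e θ = 0} := isClosed_eq he continuous_const
  have := closure_minimal (s := Set.Ioo 0 π) hIoo hcl
  rw [closure_Ioo pi_pos.ne] at this
  exact this hθ

/-- The truncated power `(t - θ)₊ ^ k`. -/
noncomputable def truncPow (k : ℕ) (t θ : ℝ) : ℝ := max (t - θ) 0 ^ k

lemma continuous_truncPow (k : ℕ) (t : ℝ) : Continuous (truncPow k t) := by
  unfold truncPow
  fun_prop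

lemma integral_truncPow_mul_weighted (m n : ℕ) {t : ℝ} (ht : t ∈ Set.Icc 0 π) :
    ∫ θ in (0)..π, truncPow (m + 1) t θ * weighted m n θ =
      (m + 1).factorial * truncCoeff m n t := by
  have hc1 := continuous_truncPow (m + 1) t
  have hc2 := continuous_weighted m n
  rw [← intervalIntegral.integral_add_adjacent_intervals (b := t)
    (Continuous.intervalIntegrable (by fun_prop) _ _)
    (Continuous.intervalIntegrable (by fun_prop) _ _), truncCoeff, iterate_primitive_eq hc2,
    ← intervalIntegral.integral_const_mul]
  have h2 : ∫ θ in t..π, truncPow (m + 1) t θ * weighted m n θ = ∫ θ in t..π, 0 := by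
    refine intervalIntegral.integral_congr fun θ hθ => ?_
    rw [Set.uIcc_of_le ht.2] at hθ
    simp [truncPow, hθ.1]
  rw [h2, intervalIntegral.integral_zero, add_zero]
  refine intervalIntegral.integral_congr fun θ hθ => ?_
  rw [Set.uIcc_of_le ht.1] at hθ
  have : ((m + 1).factorial : ℝ) ≠ 0 := by positivity
  simp only [truncPow, max_eq_left (sub_nonneg.2 hθ.2)]
  field_simp

/-- The ultraspherical coefficients of a truncated power. -/
noncomputable def expansionCoeff (m : ℕ) (t : ℝ) (n : ℕ) : ℝ :=
  (m + 1).factorial * truncCoeff m n t / normSq m n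

lemma expansionCoeff_pos {m : ℕ} (hm : 1 ≤ m) {t : ℝ} (ht : 0 < t) (n : ℕ) :
    0 < expansionCoeff m t n := by
  obtain ⟨m, rfl⟩ := Nat.exists_eq_add_of_le' hm
  exact div_pos (mul_pos (by positivity) (truncCoeff_succ_pos m n ht)) (normSq_pos hm n)

/-- The decay `n^(-2m-2)` of `truncCoeff` beats the growth `n^(2m)` of the inverse norms, leaving
order `n^(-2)`. -/
lemma summable_expansionCoeff {m : ℕ} (hm : 1 ≤ m) {t : ℝ} (ht : t ∈ Set.Ioc 0 π) :
    Summable (expansionCoeff m t) := by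
  obtain ⟨K, hK⟩ := exists_truncCoeff_le m
  rw [← summable_nat_add_iff 1]
  have hs : Summable fun n : ℕ => ((m + 1).factorial * K * (m + 1 : ℝ) ^ (2 * m)) *
      (1 / ((n + 1 : ℕ) : ℝ) ^ 2) :=
    ((summable_nat_add_iff 1).2 (Real.summable_one_div_nat_pow.2 one_lt_two)).mul_left _
  refine hs.of_nonneg_of_le (fun n => (expansionCoeff_pos hm ht.1 _).le) fun n => ?_
  have h1 := hK (n + 1) (by omega) t (Set.Ioc_subset_Icc_self ht)
  have h2 := inv_normSq_le hm (n + 1)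
  have h3 := normSq_pos hm (n + 1)
  have h4 := truncCoeff_nonneg m (n + 1) ht.1.le
  set N : ℝ := ((n + 1 : ℕ) : ℝ) with hN
  have hN1 : 1 ≤ N := by rw [hN]; push_cast; linarith [(n.cast_nonneg : (0 : ℝ) ≤ n)]
  have h5 : N + m ≤ (m + 1) * N := by
    have : (0 : ℝ) ≤ m := m.cast_nonneg
    nlinarith
  calc expansionCoeff m t (n + 1)
      = (m + 1).factorial * truncCoeff m (n + 1) t * (normSq m (n + 1))⁻¹ := div_eq_mul_inv _ _
    _ ≤ (m + 1).factorial * (K / N ^ (2 * m + 2)) * ((m + 1) * N) ^ (2 * m) := by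
        have h6 : (N + m) ^ (2 * m) ≤ ((m + 1) * N) ^ (2 * m) := by gcongr
        have h7 := h4.trans h1
        have h8 := inv_nonneg.2 h3.le
        gcongr
        exact h2.trans h6
    _ = _ := by
        rw [mul_pow, pow_add N]
        field_simp

/-- The summable coefficients and the bound `|P| ≤ 1` on `[-1, 1]` make the series converge
uniformly to a continuous `F`. By orthogonality `F` has the moments of the truncated power, so
completeness identifies them. -/
lemma hasSum_truncPow {m : ℕ} (hm : 1 ≤ m) {t θ : ℝ} (ht : t ∈ Set.Ioc 0 π)
    (hθ : θ ∈ Set.Icc 0 π) :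
    HasSum (fun n => expansionCoeff m t n * (ultra m n).eval (cos θ)) (truncPow (m + 1) t θ) := by
  have hs := summable_expansionCoeff hm ht
  have hb : ∀ n θ, ‖expansionCoeff m t n * (ultra m n).eval (cos θ)‖ ≤ expansionCoeff m t n := by
    intro n θ
    have h0 := (expansionCoeff_pos hm ht.1 n).le
    rw [norm_mul, norm_eq_abs, norm_eq_abs, abs_of_nonneg h0]
    exact mul_le_of_le_one_right h0 (abs_eval_le_one m n (abs_cos_le_one θ))
  set F : ℝ → ℝ := fun θ => ∑' n, expansionCoeff m t n * (ultra m n).eval (cos θ) with hF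
  have hFc : Continuous F :=
    continuous_tsum (fun n => continuous_const.mul (continuous_eval_cos _)) hs hb
  have hFs : ∀ θ, HasSum (fun n => expansionCoeff m t n * (ultra m n).eval (cos θ)) (F θ) :=
    fun θ => (Summable.of_norm_bounded hs (hb · θ)).hasSum
  have htc := continuous_truncPow (m + 1) t
  have key : ∀ k, ∫ θ in (0)..π, F θ * weighted m k θ = expansionCoeff m t k * normSq m k := by
    intro k
    have hk := continuous_weighted m k
    have h1 : HasSum (fun n => ∫ θ in (0)..π,
        expansionCoeff m t n * (ultra m n).eval (cos θ) * weighted m k θ)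
        (∫ θ in (0)..π, F θ * weighted m k θ) := by
      refine intervalIntegral.hasSum_integral_of_dominated_convergence
        (fun n θ => expansionCoeff m t n * |weighted m k θ|) (fun n => ?_) (fun n => ?_) ?_ ?_ ?_
      · have := continuous_eval_cos (ultra m n)
        exact Continuous.aestronglyMeasurable (by fun_prop)
      · refine Filter.Eventually.of_forall fun θ _ => ?_
        rw [norm_mul, norm_eq_abs (weighted m k θ)]
        exact mul_le_mul_of_nonneg_right (hb n θ) (abs_nonneg _)
      · exact Filter.Eventually.of_forall fun θ _ => hs.mul_right _
      · simp_rw [tsum_mul_right]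
        exact Continuous.intervalIntegrable (by fun_prop) _ _
      · exact Filter.Eventually.of_forall fun θ _ => (hFs θ).mul_right _
    have h2 : ∀ n, ∫ θ in (0)..π,
        expansionCoeff m t n * (ultra m n).eval (cos θ) * weighted m k θ =
        expansionCoeff m t n * ∫ θ in (0)..π,
          (ultra m n).eval (cos θ) * (ultra m k).eval (cos θ) * sin θ ^ (2 * m) := by
      intro n
      rw [← intervalIntegral.integral_const_mul]
      refine intervalIntegral.integral_congr fun θ _ => ?_
      simp only [weighted]
      ring
    simp_rw [h2] at h1
    refine h1.unique ?_
    rw [normSq]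
    refine hasSum_single k fun n hn => ?_
    rw [integral_ultra_of_ne m hn, mul_zero]
  have heq := eq_zero_of_integral_eq_zero (m := m) (htc.sub hFc) (fun n => ?_) hθ
  · rw [sub_eq_zero.1 heq]
    exact hFs θ
  · have hk := continuous_weighted m n
    simp_rw [Pi.sub_apply, sub_mul]
    rw [intervalIntegral.integral_sub (Continuous.intervalIntegrable (by fun_prop) _ _)
      (Continuous.intervalIntegrable (by fun_prop) _ _), key,
      integral_truncPow_mul_weighted m n (Set.Ioc_subset_Icc_self ht), expansionCoeff,
      div_mul_cancel₀ _ (normSq_pos hm n).ne', sub_self]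

/-! ### Strict positive definiteness of truncated powers -/

variable {σ : Type*} [Fintype σ]

lemma sum_mul_mem_Icc {x y : σ → ℝ} (hx : ∑ i, x i ^ 2 = 1) (hy : ∑ i, y i ^ 2 = 1) :
    ∑ i, x i * y i ∈ Set.Icc (-1 : ℝ) 1 := by
  have h := Finset.sum_mul_sq_le_sq_mul_sq Finset.univ x y
  rw [hx, hy, mul_one] at h
  exact abs_le.1 ((sq_le_one_iff_abs_le_one _).1 h)

lemma eq_of_sum_mul_eq_one {x y : σ → ℝ} (hx : ∑ i, x i ^ 2 = 1) (hy : ∑ i, y i ^ 2 = 1)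
    (h : ∑ i, x i * y i = 1) : x = y := by
  have h0 : ∑ i, (x i - y i) ^ 2 = 0 := by
    have : ∀ i, (x i - y i) ^ 2 = x i ^ 2 + y i ^ 2 - 2 * (x i * y i) := fun i => by ring
    simp_rw [this]
    rw [Finset.sum_sub_distrib, Finset.sum_add_distrib, ← Finset.mul_sum, hx, hy, h]
    norm_num
  rw [Finset.sum_eq_zero_iff_of_nonneg fun i _ => sq_nonneg _] at h0
  ext i
  exact sub_eq_zero.1 (pow_eq_zero_iff two_ne_zero |>.1 (h0 i (Finset.mem_univ i)))

/-- If the quadratic forms of all polynomial kernels vanish, then so do the coefficients. -/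
lemma eq_zero_of_forall_polynomial {ι : Type*} [Fintype ι] {x : ι → σ → ℝ}
    (hx : ∀ a, ∑ i, x a i ^ 2 = 1) (hinj : Function.Injective x) {c : ι → ℝ}
    (h : ∀ p : ℝ[X], ∑ a, ∑ b, c a * c b * p.eval (∑ i, x a i * x b i) = 0) : c = 0 := by
  classical
  -- The powers `((1 + x) / 2)^N` tend to the indicator of `x = 1` on `[-1, 1]`, antipodal points
  -- included, so the forms tend to `∑ c_a²`.
  have hlim : Filter.Tendsto (fun N : ℕ => ∑ a, ∑ b, c a * c b *
      ((C (1 / 2) * (1 + X)) ^ N : ℝ[X]).eval (∑ i, x a i * x b i)) Filter.atTop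
      (nhds (∑ a, ∑ b, c a * c b * if a = b then 1 else 0)) := by
    refine tendsto_finsetSum _ fun a _ => tendsto_finsetSum _ fun b _ =>
      Filter.Tendsto.const_mul _ ?_
    simp only [eval_pow, eval_mul, eval_C, eval_add, Polynomial.eval_one, eval_X]
    by_cases hab : a = b
    · subst hab
      have : ∑ i, x a i * x a i = 1 := by simpa [sq] using hx a
      rw [this, if_pos rfl]
      norm_num
    · rw [if_neg hab]
      have h1 := sum_mul_mem_Icc (hx a) (hx b)
      have h2 : ∑ i, x a i * x b i ≠ 1 := fun h =>
        hab (hinj (eq_of_sum_mul_eq_one (hx a) (hx b) h))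
      have h3 := lt_of_le_of_ne h1.2 h2
      exact tendsto_pow_atTop_nhds_zero_of_lt_one (by linarith [h1.1]) (by linarith)
  simp_rw [h] at hlim
  have h0 := tendsto_nhds_unique hlim tendsto_const_nhds
  simp only [mul_ite, mul_one, mul_zero, Finset.sum_ite_eq, Finset.mem_univ, if_true] at h0
  rw [Finset.sum_eq_zero_iff_of_nonneg fun i _ => mul_self_nonneg _] at h0
  ext a
  exact mul_self_eq_zero.1 (h0 a (Finset.mem_univ a))

/-- The truncated power `(t - θ)₊ ^ (m + 1)` is strictly positive definite on the unit sphere of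
a Euclidean space of dimension `2 m + 2`. -/
lemma sum_mul_truncPow_pos {m : ℕ} (hm : 1 ≤ m) {t : ℝ} (ht : t ∈ Set.Ioc 0 π)
    (hσ : Fintype.card σ = 2 * m + 2) {ι : Type*} [Fintype ι] {x : ι → σ → ℝ}
    (hx : ∀ a, ∑ i, x a i ^ 2 = 1) (hinj : Function.Injective x) {c : ι → ℝ} (hc : c ≠ 0) :
    0 < ∑ a, ∑ b, c a * c b * truncPow (m + 1) t (arccos (∑ i, x a i * x b i)) := by
  have hQ : ∀ n, 0 ≤ ∑ a, ∑ b, c a * c b * (ultra m n).eval (∑ i, x a i * x b i) := fun n =>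
    Fischer.sum_mul_eval_nonneg (ode m n) (natDegree_eq m n).le (coeff_self_pos m n) hσ x hx c
  have hsum : HasSum (fun n => expansionCoeff m t n *
      ∑ a, ∑ b, c a * c b * (ultra m n).eval (∑ i, x a i * x b i))
      (∑ a, ∑ b, c a * c b * truncPow (m + 1) t (arccos (∑ i, x a i * x b i))) := by
    simp_rw [Finset.mul_sum]
    refine hasSum_sum fun a _ => hasSum_sum fun b _ => ?_
    have h1 := sum_mul_mem_Icc (hx a) (hx b)
    have h := (hasSum_truncPow hm ht ⟨arccos_nonneg (∑ i, x a i * x b i),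
      arccos_le_pi _⟩).mul_left (c a * c b)
    rw [cos_arccos h1.1 h1.2] at h
    simpa only [mul_left_comm (expansionCoeff m t _)] using h
  -- A nonpositive sum of nonnegative terms with positive coefficients makes every ultraspherical
  -- form vanish, hence by spanning every polynomial form.
  by_contra hcon
  have h0 : ∀ n, ∑ a, ∑ b, c a * c b * (ultra m n).eval (∑ i, x a i * x b i) = 0 := by
    intro n
    have h1 := le_hasSum hsum n fun k _ => mul_nonneg (expansionCoeff_pos hm ht.1 k).le (hQ k)
    have h2 := nonpos_of_mul_nonpos_right (h1.trans (not_lt.1 hcon)) (expansionCoeff_pos hm ht.1 n)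
    exact le_antisymm h2 (hQ n)
  refine hc (eq_zero_of_forall_polynomial hx hinj fun p => ?_)
  let L : ℝ[X] →ₗ[ℝ] ℝ := ∑ a, ∑ b, (c a * c b) • Polynomial.leval (∑ i, x a i * x b i)
  have hL : ∀ p, L p = ∑ a, ∑ b, c a * c b * p.eval (∑ i, x a i * x b i) := fun p => by
    simp [L, LinearMap.sum_apply]
  rw [← hL]
  exact eq_zero_of_forall_ultra m L (fun n => by rw [hL, h0]) p

end Ultra

/-! ### Convex functions as mixtures of truncated powers -/

namespace ConvexLayer

open Real MeasureTheory Set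

/-- A convex function on `[0, π]` that vanishes with its derivative at `π` and is differentiable
at `0` is the integral of a bounded nonnegative antitone function. -/
lemma exists_antitone_integral {h : ℝ → ℝ} (hconv : ConvexOn ℝ (Icc 0 π) h)
    (hcont : ContinuousOn h (Icc 0 π)) (hpi : h π = 0) (hpi' : HasDerivWithinAt h 0 (Icc 0 π) π)
    (hzero : DifferentiableWithinAt ℝ h (Icc 0 π) 0) :
    ∃ (k : ℝ → ℝ) (K : ℝ), Antitone k ∧ (∀ t, 0 ≤ k t) ∧ (∀ t, k t ≤ K) ∧ (∀ t, π ≤ t → k t = 0) ∧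
      ∀ θ ∈ Icc 0 π, h θ = ∫ t in θ..π, k t := by
  have h0m : (0 : ℝ) ∈ Icc 0 π := ⟨le_rfl, pi_pos.le⟩
  have hπm : π ∈ Icc 0 π := ⟨pi_pos.le, le_rfl⟩
  have hint : interior (Icc 0 π) = Ioo 0 π := interior_Icc
  set rd : ℝ → ℝ := fun t => derivWithin h (Ioi t) t with hrd
  set K : ℝ := -derivWithin h (Icc 0 π) 0 with hK
  have hle0 : ∀ t ∈ Ioo 0 π, 0 ≤ -rd t := by
    intro t ht
    have h1 := hconv.rightDeriv_le_slope_of_mem_interior (hint ▸ ht) hπm ht.2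
    have h2 := hconv.slope_le_of_hasDerivWithinAt (Ioo_subset_Icc_self ht) hπm ht.2 hpi'
    exact neg_nonneg.2 (h1.trans h2)
  have hleK : ∀ t ∈ Ioo 0 π, -rd t ≤ K := by
    intro t ht
    have h1 := hconv.le_slope_of_hasDerivWithinAt h0m (Ioo_subset_Icc_self ht) ht.1
      hzero.hasDerivWithinAt
    have h2 := hconv.slope_le_leftDeriv_of_mem_interior h0m (hint ▸ ht) ht.1
    have h3 := hconv.leftDeriv_le_rightDeriv_of_mem_interior (hint ▸ ht)
    exact neg_le_neg (h1.trans (h2.trans h3))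
  have hK0 : 0 ≤ K :=
    (hle0 (π / 2) ⟨by positivity, by linarith [pi_pos]⟩).trans
      (hleK _ ⟨by positivity, by linarith [pi_pos]⟩)
  have hmono : ∀ s ∈ Ioo 0 π, ∀ t ∈ Ioo 0 π, s ≤ t → -rd t ≤ -rd s := fun s hs t ht hst =>
    neg_le_neg (hconv.monotoneOn_rightDeriv (hint ▸ hs) (hint ▸ ht) hst)
  -- Inside the interval `k` is minus the right derivative. Convexity bounds it by the endpoint
  -- slopes `K` at `0` and `0` at `π`, so these constant extensions keep it antitone.
  set k : ℝ → ℝ := fun t => if t ≤ 0 then K else if t < π then -rd t else 0 with hk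
  have hkI : ∀ t ∈ Ioo 0 π, k t = -rd t := fun t ht => by
    simp only [hk]
    rw [if_neg ht.1.not_ge, if_pos ht.2]
  have hk0 : ∀ t, 0 ≤ k t := fun t => by
    simp only [hk]
    split_ifs with h1 h2
    · exact hK0
    · exact hle0 t ⟨not_le.1 h1, h2⟩
    · exact le_rfl
  have hkK : ∀ t, k t ≤ K := fun t => by
    simp only [hk]
    split_ifs with h1 h2
    · exact le_rfl
    · exact hleK t ⟨not_le.1 h1, h2⟩
    · exact hK0
  have hanti : Antitone k := by
    intro s t hst
    by_cases hs : s ≤ 0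
    · exact (hkK t).trans_eq (by simp only [hk]; rw [if_pos hs])
    by_cases ht : t < π
    · rw [hkI s ⟨not_le.1 hs, hst.trans_lt ht⟩, hkI t ⟨(not_le.1 hs).trans_le hst, ht⟩]
      exact hmono s ⟨not_le.1 hs, hst.trans_lt ht⟩ t ⟨(not_le.1 hs).trans_le hst, ht⟩ hst
    · have : k t = 0 := by
        simp only [hk]
        rw [if_neg ((not_le.1 hs).trans_le hst).not_ge, if_neg ht]
      rw [this]
      exact hk0 s
  refine ⟨k, K, hanti, hk0, hkK, fun t ht => ?_, fun θ hθ => ?_⟩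
  · simp only [hk]
    rw [if_neg (pi_pos.trans_le ht).not_ge, if_neg ht.not_gt]
  · have h1 := intervalIntegral.integral_eq_sub_of_hasDeriv_right_of_le (f := h)
      (f' := fun t => -k t) hθ.2 (hcont.mono (Icc_subset_Icc_left hθ.1)) (fun t ht => ?_)
      hanti.intervalIntegrable.neg
    · rw [intervalIntegral.integral_neg, hpi] at h1
      linarith
    · have ht' : t ∈ Ioo 0 π := ⟨hθ.1.trans_lt ht.1, ht.2⟩
      rw [hkI t ht', neg_neg]
      exact hconv.hasDerivWithinAt_rightDeriv_of_mem_interior (hint ▸ ht')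

/-- `τ s` is the supremum of `{t | s < k t}`. Adjoining `t ≤ 0` keeps the set nonempty, and `max s
0` keeps it below `π` for negative `s`. Whether `τ s` itself belongs is left open, hence one strict
and one weak implication. -/
lemma exists_inverse {k : ℝ → ℝ} (hk : Antitone k) (hkpi : ∀ t, π ≤ t → k t = 0) :
    ∃ τ : ℝ → ℝ, Antitone τ ∧ (∀ s, τ s ∈ Icc 0 π) ∧
      ∀ s, 0 ≤ s → ∀ t, 0 < t → (t < τ s → s < k t) ∧ (s < k t → t ≤ τ s) := by
  set S : ℝ → Set ℝ := fun s => {t | t ≤ 0 ∨ max s 0 < k t} with hS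
  have hub : ∀ s, ∀ t ∈ S s, t ≤ π := by
    rintro s t (ht | ht)
    · exact ht.trans pi_pos.le
    · by_contra hcon
      rw [hkpi t (not_le.1 hcon).le] at ht
      exact ((le_max_right s 0).trans_lt ht).false
  have hbdd : ∀ s, BddAbove (S s) := fun s => ⟨π, hub s⟩
  have h0 : ∀ s, (0 : ℝ) ∈ S s := fun s => Or.inl le_rfl
  refine ⟨fun s => sSup (S s), fun s s' hss => csSup_le_csSup (hbdd s) ⟨0, h0 s'⟩ ?_,
    fun s => ⟨le_csSup (hbdd s) (h0 s), csSup_le ⟨0, h0 s⟩ (hub s)⟩,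
    fun s hs t ht => ⟨fun h => ?_, fun h => le_csSup (hbdd s) (Or.inr ?_)⟩⟩
  · rintro t (ht | ht)
    · exact Or.inl ht
    · exact Or.inr ((max_le_max_right 0 hss).trans_lt ht)
  · obtain ⟨u, hu, htu⟩ := exists_lt_of_lt_csSup ⟨0, h0 s⟩ h
    rcases hu with hu | hu
    · exact absurd (ht.trans (htu.trans_le hu)) (lt_irrefl _)
    · exact (le_max_left s 0).trans_lt (hu.trans_le (hk htu.le))
  · rwa [max_eq_left hs]

lemma truncPow_nonneg (k : ℕ) (t θ : ℝ) : 0 ≤ Ultra.truncPow k t θ :=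
  pow_nonneg (le_max_right _ _) _

lemma truncPow_le {k : ℕ} {t θ : ℝ} (ht : t ≤ π) (hθ : 0 ≤ θ) : Ultra.truncPow k t θ ≤ π ^ k := by
  refine pow_le_pow_left₀ (le_max_right _ _) (max_le (by linarith) pi_pos.le) _

lemma integral_truncPow (k : ℕ) {t θ : ℝ} (ht : t ≤ π) (hθ : θ ≤ π) :
    ∫ u in θ..π, Ultra.truncPow (k + 1) t u = Ultra.truncPow (k + 2) t θ / (k + 2) := by
  have hc := Ultra.continuous_truncPow (k + 1) t
  rcases le_total t θ with h | h
  · have h1 : ∫ u in θ..π, Ultra.truncPow (k + 1) t u = ∫ u in θ..π, 0 := by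
      refine intervalIntegral.integral_congr fun u hu => ?_
      rw [uIcc_of_le hθ] at hu
      simp [Ultra.truncPow, h.trans hu.1]
    rw [h1]
    simp [Ultra.truncPow, h]
  · rw [← intervalIntegral.integral_add_adjacent_intervals (b := t)
      (hc.intervalIntegrable _ _) (hc.intervalIntegrable _ _)]
    have h1 : ∫ u in t..π, Ultra.truncPow (k + 1) t u = ∫ u in t..π, 0 := by
      refine intervalIntegral.integral_congr fun u hu => ?_
      rw [uIcc_of_le ht] at hu
      simp [Ultra.truncPow, hu.1]
    have h2 : ∫ u in θ..t, Ultra.truncPow (k + 1) t u = ∫ u in θ..t, (t - u) ^ (k + 1) := by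
      refine intervalIntegral.integral_congr fun u hu => ?_
      rw [uIcc_of_le h] at hu
      simp only [Ultra.truncPow, max_eq_left (sub_nonneg.2 hu.2)]
    rw [h1, h2, intervalIntegral.integral_comp_sub_left (fun x => x ^ (k + 1)) t, integral_pow]
    simp [Ultra.truncPow, max_eq_left (sub_nonneg.2 h)]
    ring

lemma measurable_truncPow_comp (k : ℕ) {τ : ℝ → ℝ} (hτ : Antitone τ) :
    Measurable fun p : ℝ × ℝ => Ultra.truncPow k (τ p.2) p.1 := by
  have := hτ.measurable
  unfold Ultra.truncPow
  fun_prop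

lemma intervalIntegrable_truncPow (k : ℕ) {τ : ℝ → ℝ} (hτ : Antitone τ)
    (hτI : ∀ s, τ s ∈ Icc 0 π) {θ : ℝ} (hθ : 0 ≤ θ) (a b : ℝ) :
    IntervalIntegrable (fun s => Ultra.truncPow k (τ s) θ) volume a b := by
  rw [intervalIntegrable_iff, uIoc]
  refine Integrable.of_bound (Measurable.aestronglyMeasurable ?_) (π ^ k)
    (Filter.Eventually.of_forall fun s => ?_)
  · exact (measurable_truncPow_comp k hτ).comp (measurable_const.prodMk measurable_id)
  · rw [norm_of_nonneg (truncPow_nonneg _ _ _)]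
    exact truncPow_le (hτI s).2 hθ

/-- Interchange of two integrals of a bounded measurable function. -/
lemma integral_swap_of_bounded {f : ℝ → ℝ → ℝ} (hf : Measurable (Function.uncurry f))
    {a b c d B : ℝ} (hab : a ≤ b) (hcd : c ≤ d) (hB : ∀ x ∈ Ioc a b, ∀ y, ‖f x y‖ ≤ B) :
    ∫ x in a..b, ∫ y in c..d, f x y = ∫ y in c..d, ∫ x in a..b, f x y := by
  simp only [intervalIntegral.integral_of_le hab, intervalIntegral.integral_of_le hcd]
  refine integral_integral_swap (Integrable.of_bound hf.aestronglyMeasurable B ?_)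
  rw [Measure.prod_restrict]
  refine (ae_restrict_iff' (measurableSet_Ioc.prod measurableSet_Ioc)).2
    (Filter.Eventually.of_forall fun p hp => hB p.1 hp.1 p.2)

lemma integral_truncPow_swap (k : ℕ) {τ : ℝ → ℝ} (hτ : Antitone τ)
    (hτI : ∀ s, τ s ∈ Icc 0 π) {K : ℝ} (hK : 0 ≤ K) {θ : ℝ} (hθ : θ ∈ Icc 0 π) :
    ∫ u in θ..π, ∫ s in (0)..K, Ultra.truncPow (k + 1) (τ s) u =
      (∫ s in (0)..K, Ultra.truncPow (k + 2) (τ s) θ) / (k + 2) := by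
  rw [integral_swap_of_bounded (f := fun u s => Ultra.truncPow (k + 1) (τ s) u)
      (B := π ^ (k + 1)) (measurable_truncPow_comp _ hτ) hθ.2 hK,
    ← intervalIntegral.integral_div]
  · exact intervalIntegral.integral_congr fun s _ => integral_truncPow k (hτI s).2 hθ.2
  · intro u hu s
    rw [norm_of_nonneg (truncPow_nonneg _ _ _)]
    exact truncPow_le (hτI s).2 (hθ.1.trans hu.1.le)

/-- The layer-cake representation of the integral of an antitone function. -/
lemma integral_eq_integral_truncPow {k τ : ℝ → ℝ} {K : ℝ} (hk : Antitone k) (hk0 : ∀ t, 0 ≤ k t)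
    (hkK : ∀ t, k t ≤ K) (hτI : ∀ s, τ s ∈ Icc 0 π)
    (hτk : ∀ s, 0 ≤ s → ∀ t, 0 < t → (t < τ s → s < k t) ∧ (s < k t → t ≤ τ s))
    {θ : ℝ} (hθ : θ ∈ Icc 0 π) :
    ∫ t in θ..π, k t = ∫ s in (0)..K, Ultra.truncPow 1 (τ s) θ := by
  have hK : 0 ≤ K := (hk0 0).trans (hkK 0)
  set f : ℝ → ℝ → ℝ := fun t s => if s < k t then 1 else 0 with hf
  have hfm : Measurable (Function.uncurry f) :=
    Measurable.ite (measurableSet_lt measurable_snd (hk.measurable.comp measurable_fst))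
      measurable_const measurable_const
  have h1 : ∀ t, k t = ∫ s in (0)..K, f t s := by
    intro t
    have e : f t = (Iio (k t)).indicator fun _ => 1 := by
      ext s
      simp [hf, indicator_apply]
    rw [intervalIntegral.integral_of_le hK, e, setIntegral_indicator measurableSet_Iio]
    have e2 : Ioc 0 K ∩ Iio (k t) = Ioo 0 (k t) := by
      ext s
      simp only [mem_inter_iff, mem_Ioc, mem_Iio, mem_Ioo]
      exact ⟨fun h => ⟨h.1.1, h.2⟩, fun h => ⟨⟨h.1, h.2.le.trans (hkK t)⟩, h.2⟩⟩
    rw [e2, setIntegral_const, Real.volume_real_Ioo_of_le (hk0 t)]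
    simp
  -- Each level set in `(θ, π]` lies between `(θ, τ s)` and `(θ, τ s]`, so its length is `(τ s -
  -- θ)₊`.
  have h2 : ∀ s, 0 ≤ s → ∫ t in θ..π, f t s = Ultra.truncPow 1 (τ s) θ := by
    intro s hs
    have e : (fun t => f t s) = {t | s < k t}.indicator fun _ => 1 := by
      ext t
      simp [hf, indicator_apply]
    have hm : MeasurableSet {t | s < k t} := measurableSet_lt measurable_const hk.measurable
    rw [intervalIntegral.integral_of_le hθ.2, e, setIntegral_indicator hm, setIntegral_const]
    simp only [smul_eq_mul, mul_one, Ultra.truncPow, pow_one]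
    refine le_antisymm ?_ ?_
    · rw [← Real.volume_real_Ioc]
      refine measureReal_mono (fun t ht => ⟨ht.1.1, ?_⟩) (by simp)
      exact (hτk s hs t (hθ.1.trans_lt ht.1.1)).2 ht.2
    · rw [← Real.volume_real_Ioo]
      refine measureReal_mono (fun t ht => ⟨⟨ht.1, ht.2.le.trans (hτI s).2⟩, ?_⟩) ?_
      · exact (hτk s hs t (hθ.1.trans_lt ht.1)).1 ht.2
      · exact ((measure_mono inter_subset_left).trans_lt (by simp)).ne
  simp_rw [h1]
  rw [integral_swap_of_bounded hfm hθ.2 hK (B := 1)]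
  · refine intervalIntegral.integral_congr fun s hs => ?_
    rw [uIcc_of_le hK] at hs
    exact h2 s hs.1
  · intro t _ s
    simp only [hf]
    split_ifs <;> simp

lemma derivOnIcc_eq_neg_integral {g : ℝ → ℝ} {m i : ℕ} (hg : ContDiffOn ℝ m g (Icc 0 π))
    (hi : i < m) (hpi : derivOnIcc i g π = 0) {θ : ℝ} (hθ : θ ∈ Icc 0 π) :
    derivOnIcc i g θ = -∫ u in θ..π, derivOnIcc (i + 1) g u := by
  have hu := uniqueDiffOn_Icc pi_pos
  have hsub : Icc θ π ⊆ Icc 0 π := Icc_subset_Icc_left hθ.1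
  have hc1 := hg.continuousOn_iteratedDerivWithin (m := i) (by exact_mod_cast hi.le) hu
  have hc2 := hg.continuousOn_iteratedDerivWithin (m := i + 1) (by exact_mod_cast hi) hu
  have hd := hg.differentiableOn_iteratedDerivWithin (m := i) (by exact_mod_cast hi) hu
  have h := intervalIntegral.integral_eq_sub_of_hasDerivAt_of_le (f := derivOnIcc i g)
    (f' := derivOnIcc (i + 1) g) hθ.2 (hc1.mono hsub) (fun u hu' => ?_) ?_
  · rw [h, hpi]
    ring
  · have hmem : u ∈ Ioo 0 π := ⟨hθ.1.trans_lt hu'.1, hu'.2⟩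
    have := (hd u (Ioo_subset_Icc_self hmem)).hasDerivWithinAt.hasDerivAt
      (Icc_mem_nhds hmem.1 hmem.2)
    rw [show derivOnIcc (i + 1) g u = _ from congr_fun iteratedDerivWithin_succ u]
    exact this
  · refine ContinuousOn.intervalIntegrable ?_
    rw [uIcc_of_le hθ.2]
    exact hc2.mono hsub

/-- Under the hypotheses of the Pólya criterion, `g` is a mixture of truncated powers. -/
lemma eq_integral_truncPow {m : ℕ} {g : ℝ → ℝ} (hg : ContDiffOn ℝ m g (Icc 0 π))
    (hpi : ∀ j ≤ m, derivOnIcc j g π = 0) {τ : ℝ → ℝ} {K : ℝ} (hK : 0 ≤ K) (hτ : Antitone τ)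
    (hτI : ∀ s, τ s ∈ Icc 0 π)
    (htop : ∀ θ ∈ Icc 0 π,
      (-1) ^ m * derivOnIcc m g θ = ∫ s in (0)..K, Ultra.truncPow 1 (τ s) θ)
    {θ : ℝ} (hθ : θ ∈ Icc 0 π) :
    g θ = (∫ s in (0)..K, Ultra.truncPow (m + 1) (τ s) θ) / (m + 1).factorial := by
  -- Induct downwards on the order `i = m - j` of the derivative: integrating from `π` flips the
  -- sign, raises the exponent by one and supplies the next factor of the factorial.
  have key : ∀ j i, i + j = m → ∀ θ ∈ Icc 0 π, (-1) ^ i * derivOnIcc i g θ =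
      (∫ s in (0)..K, Ultra.truncPow (j + 1) (τ s) θ) / (j + 1).factorial := by
    intro j
    induction j with
    | zero =>
      rintro i rfl θ hθ
      simpa using htop θ hθ
    | succ j ih =>
      intro i hij θ hθ
      rw [derivOnIcc_eq_neg_integral hg (by omega) (hpi i (by omega)) hθ]
      have h1 : (-1 : ℝ) ^ i * -∫ u in θ..π, derivOnIcc (i + 1) g u =
          ∫ u in θ..π, (-1) ^ (i + 1) * derivOnIcc (i + 1) g u := by
        rw [intervalIntegral.integral_const_mul]
        ring
      have h2 : ∫ u in θ..π, (-1) ^ (i + 1) * derivOnIcc (i + 1) g u = ∫ u in θ..π,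
          (∫ s in (0)..K, Ultra.truncPow (j + 1) (τ s) u) / (j + 1).factorial := by
        refine intervalIntegral.integral_congr fun u hu => ?_
        rw [uIcc_of_le hθ.2] at hu
        exact ih (i + 1) (by omega) u ⟨hθ.1.trans hu.1, hu.2⟩
      rw [h1, h2, intervalIntegral.integral_div, integral_truncPow_swap j hτ hτI hK hθ,
        Nat.factorial_succ (j + 1)]
      push_cast
      field_simp
      ring
  have h := key m 0 (by omega) θ hθ
  rw [pow_zero, one_mul, derivOnIcc, iteratedDerivWithin_zero] at h
  exact h

end ConvexLayer

/-! ### Quadratic forms on the sphere and the criterion -/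

namespace SpherePolya

open Real MeasureTheory Set

/-- The coordinates of a point of the sphere, padded by zeros. -/
noncomputable def pad {d : ℕ} (e : ℕ) (x : Metric.sphere (0 : EuclideanSpace ℝ (Fin d)) 1) :
    Fin d ⊕ Fin e → ℝ :=
  Sum.elim (fun i => (x : EuclideanSpace ℝ (Fin d)) i) 0

lemma sum_pad_mul_pad {d : ℕ} (e : ℕ) (x y : Metric.sphere (0 : EuclideanSpace ℝ (Fin d)) 1) :
    ∑ i, pad e x i * pad e y i =
      inner ℝ (x : EuclideanSpace ℝ (Fin d)) (y : EuclideanSpace ℝ (Fin d)) := by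
  simp [pad, PiLp.inner_apply, mul_comm]

lemma sum_pad_sq {d : ℕ} (e : ℕ) (x : Metric.sphere (0 : EuclideanSpace ℝ (Fin d)) 1) :
    ∑ i, pad e x i ^ 2 = 1 := by
  simp_rw [sq]
  rw [sum_pad_mul_pad, real_inner_self_eq_norm_sq, norm_eq_of_mem_sphere, one_pow]

lemma pad_injective {d : ℕ} (e : ℕ) :
    Function.Injective (pad e : Metric.sphere (0 : EuclideanSpace ℝ (Fin d)) 1 → _) := by
  intro x y h
  ext i
  exact congr_fun h (Sum.inl i)

lemma sphereMatrix_isHermitian {d N : ℕ} (g : ℝ → ℝ)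
    (x : Fin N → Metric.sphere (0 : EuclideanSpace ℝ (Fin d)) 1) :
    (sphereMatrix g x).IsHermitian := by
  ext i j
  simp [sphereMatrix, sphereDist, real_inner_comm]

lemma star_dotProduct_sphereMatrix {d N : ℕ} (e : ℕ) (g : ℝ → ℝ)
    (x : Fin N → Metric.sphere (0 : EuclideanSpace ℝ (Fin d)) 1) (c : Fin N → ℝ) :
    star c ⬝ᵥ (sphereMatrix g x).mulVec c =
      ∑ a, ∑ b, c a * c b * g (arccos (∑ i, pad e (x a) i * pad e (x b) i)) := by
  simp only [dotProduct, Matrix.mulVec, sphereMatrix, sphereDist, Matrix.of_apply, star_trivial,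
    sum_pad_mul_pad, Finset.mul_sum]
  exact Finset.sum_congr rfl fun a _ => Finset.sum_congr rfl fun b _ => by ring

lemma truncPow_zero_left (m : ℕ) {θ : ℝ} (hθ : 0 ≤ θ) : Ultra.truncPow (m + 1) 0 θ = 0 := by
  simp [Ultra.truncPow, hθ]

lemma intervalIntegrable_sum {ι : Type*} [Fintype ι] {f : ι → ℝ → ℝ} {a b : ℝ}
    (h : ∀ i, IntervalIntegrable (f i) volume a b) :
    IntervalIntegrable (fun s => ∑ i, f i s) volume a b := by
  have := IntervalIntegrable.sum (μ := volume) Finset.univ fun i _ => h i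
  simpa only [Finset.sum_fn] using this

variable {σ : Type*} [Fintype σ]

/-- The quadratic form of a truncated power. -/
noncomputable def quadForm (m : ℕ) {ι : Type*} [Fintype ι] (x : ι → σ → ℝ) (c : ι → ℝ)
    (t : ℝ) : ℝ :=
  ∑ a, ∑ b, c a * c b * Ultra.truncPow (m + 1) t (arccos (∑ i, x a i * x b i))

lemma quadForm_nonneg {m : ℕ} (hm : 1 ≤ m) (hσ : Fintype.card σ = 2 * m + 2) {ι : Type*}
    [Fintype ι] {x : ι → σ → ℝ} (hx : ∀ a, ∑ i, x a i ^ 2 = 1) (hinj : Function.Injective x)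
    (c : ι → ℝ) {t : ℝ} (ht : t ∈ Icc 0 π) : 0 ≤ quadForm m x c t := by
  rcases eq_or_ne c 0 with rfl | hc
  · simp [quadForm]
  -- For `t = 0` the truncated power vanishes on `[0, π]`, so it is only nonnegative definite.
  rcases ht.1.eq_or_lt with rfl | h0
  · simp [quadForm, truncPow_zero_left m (arccos_nonneg _)]
  · exact (Ultra.sum_mul_truncPow_pos hm ⟨h0, ht.2⟩ hσ hx hinj hc).le

lemma intervalIntegrable_quadForm (m : ℕ) {ι : Type*} [Fintype ι] (x : ι → σ → ℝ) (c : ι → ℝ)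
    {τ : ℝ → ℝ} (hτ : Antitone τ) (hτI : ∀ s, τ s ∈ Icc 0 π) (a b : ℝ) :
    IntervalIntegrable (fun s => quadForm m x c (τ s)) volume a b := by
  unfold quadForm
  refine intervalIntegrable_sum fun i => intervalIntegrable_sum fun j => ?_
  exact (ConvexLayer.intervalIntegrable_truncPow (m + 1) hτ hτI (arccos_nonneg _) a b).const_mul _

lemma sum_mul_eq_integral_quadForm {m : ℕ} {g : ℝ → ℝ} {τ : ℝ → ℝ} {K : ℝ} (hτ : Antitone τ)
    (hτI : ∀ s, τ s ∈ Icc 0 π)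
    (hg : ∀ θ ∈ Icc 0 π,
      g θ = (∫ s in (0)..K, Ultra.truncPow (m + 1) (τ s) θ) / (m + 1).factorial)
    {ι : Type*} [Fintype ι] (x : ι → σ → ℝ) (c : ι → ℝ) :
    ∑ a, ∑ b, c a * c b * g (arccos (∑ i, x a i * x b i)) =
      (∫ s in (0)..K, quadForm m x c (τ s)) / (m + 1).factorial := by
  have hi : ∀ a b, IntervalIntegrable (fun s => c a * c b * Ultra.truncPow (m + 1) (τ s)
      (arccos (∑ i, x a i * x b i))) volume 0 K := fun a b =>
    (ConvexLayer.intervalIntegrable_truncPow (m + 1) hτ hτI (arccos_nonneg _) 0 K).const_mul _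
  unfold quadForm
  rw [intervalIntegral.integral_finsetSum fun a _ => intervalIntegrable_sum fun b => hi a b,
    Finset.sum_div]
  refine Finset.sum_congr rfl fun a _ => ?_
  rw [intervalIntegral.integral_finsetSum fun b _ => hi a b, Finset.sum_div]
  refine Finset.sum_congr rfl fun b _ => ?_
  rw [hg _ ⟨arccos_nonneg _, arccos_le_pi _⟩, intervalIntegral.integral_const_mul]
  ring

end SpherePolya

open SpherePolya in
theorem mainTheorem3 (d lam : ℕ) (hd : 3 ≤ d) (hlam : lam = ⌈((d : ℝ) - 2) / 2⌉₊)
    (g : ℝ → ℝ) (hg : ContDiffOn ℝ lam g (Set.Icc 0 Real.pi))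
    (hconvex : ConvexOn ℝ (Set.Icc 0 Real.pi) fun θ => (-1) ^ lam * derivOnIcc lam g θ)
    (hpi : ∀ j ≤ lam, derivOnIcc j g Real.pi = 0)
    (hpi' : HasDerivWithinAt (derivOnIcc lam g) 0 (Set.Icc 0 Real.pi) Real.pi)
    (hzero : DifferentiableWithinAt ℝ (derivOnIcc lam g) (Set.Icc 0 Real.pi) 0) :
    IsSpherePosDef d g ∧
      ((¬ ∃ a b : ℝ, ∀ θ ∈ Set.Icc 0 Real.pi, derivOnIcc lam g θ = a * θ + b) →
        IsSphereStrictPosDef d g) := by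
  have hd' : (3 : ℝ) ≤ d := by exact_mod_cast hd
  have hm : 1 ≤ lam := by
    rw [hlam]
    exact Nat.ceil_pos.2 (by linarith)
  have hdm : d ≤ 2 * lam + 2 := by
    have h := Nat.le_ceil (((d : ℝ) - 2) / 2)
    rw [← hlam] at h
    have : (d : ℝ) ≤ 2 * lam + 2 := by linarith
    exact_mod_cast this
  -- The number of padding coordinates: `0` for even `d` and `1` for odd `d`.
  set e := 2 * lam + 2 - d with he
  have hcard : Fintype.card (Fin d ⊕ Fin e) = 2 * lam + 2 := by
    simp only [Fintype.card_sum, Fintype.card_fin]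
    omega
  have hcont : ContinuousOn (fun θ => (-1) ^ lam * derivOnIcc lam g θ) (Set.Icc 0 Real.pi) :=
    (hg.continuousOn_iteratedDerivWithin le_rfl (uniqueDiffOn_Icc Real.pi_pos)).const_smul
      ((-1 : ℝ) ^ lam)
  obtain ⟨k, K, hk, hk0, hkK, hkpi, hrep⟩ := ConvexLayer.exists_antitone_integral hconvex hcont
    (by simp [hpi lam le_rfl]) ((hpi'.const_mul ((-1 : ℝ) ^ lam)).congr_deriv (mul_zero _))
    (hzero.const_mul _)
  have hK : 0 ≤ K := (hk0 0).trans (hkK 0)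
  obtain ⟨τ, hτ, hτI, hτk⟩ := ConvexLayer.exists_inverse hk hkpi
  have hg' : ∀ θ ∈ Set.Icc 0 Real.pi, g θ =
      (∫ s in (0)..K, Ultra.truncPow (lam + 1) (τ s) θ) / (lam + 1).factorial := fun θ hθ =>
    ConvexLayer.eq_integral_truncPow hg hpi hK hτ hτI (fun θ hθ => (hrep θ hθ).trans
      (ConvexLayer.integral_eq_integral_truncPow hk hk0 hkK hτI hτk hθ)) hθ
  refine ⟨⟨hg.continuousOn, fun N x hx => ?_⟩, fun hlin => ⟨hg.continuousOn, fun N x hx => ?_⟩⟩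
  · refine Matrix.PosSemidef.of_dotProduct_mulVec_nonneg (sphereMatrix_isHermitian g x) fun c => ?_
    rw [star_dotProduct_sphereMatrix e, sum_mul_eq_integral_quadForm hτ hτI hg']
    refine div_nonneg (intervalIntegral.integral_nonneg hK fun s _ => ?_) (by positivity)
    exact quadForm_nonneg hm hcard (fun a => sum_pad_sq e (x a)) ((pad_injective e).comp hx) c
      (hτI s)
  · refine Matrix.PosDef.of_dotProduct_mulVec_pos (sphereMatrix_isHermitian g x) fun c hc => ?_
    rw [star_dotProduct_sphereMatrix e, sum_mul_eq_integral_quadForm hτ hτI hg']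
    refine div_pos ?_ (by positivity)
    -- If `k` vanished on `(0, ∞)`, then `g^(lam)` would be zero, in particular affine.
    obtain ⟨t, ht0, hkt⟩ : ∃ t, 0 < t ∧ 0 < k t := by
      by_contra! hcon
      refine hlin ⟨0, 0, fun θ hθ => ?_⟩
      have h1 : ∫ t in θ..Real.pi, k t = 0 := by
        rw [intervalIntegral.integral_of_le hθ.2]
        refine MeasureTheory.setIntegral_eq_zero_of_forall_eq_zero fun t ht => ?_
        exact le_antisymm (hcon t (hθ.1.trans_lt ht.1)) (hk0 t)
      have h2 := (hrep θ hθ).trans h1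
      simpa using h2
    have hnn : ∀ s, 0 ≤ quadForm lam (fun a => pad e (x a)) c (τ s) := fun s =>
      quadForm_nonneg hm hcard (fun a => sum_pad_sq e (x a)) ((pad_injective e).comp hx) c (hτI s)
    have hint := intervalIntegrable_quadForm lam (fun a => pad e (x a)) c hτ hτI
    -- For `0 < s < k t` one has `τ s ≥ t > 0`, so the integrand is strictly positive on an interval
    -- of positive length; on the rest it is nonnegative.
    rw [← intervalIntegral.integral_add_adjacent_intervals (hint 0 (k t)) (hint (k t) K)]
    refine add_pos_of_pos_of_nonneg ?_
      (intervalIntegral.integral_nonneg (hkK t) fun s _ => hnn s)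
    refine intervalIntegral.intervalIntegral_pos_of_pos_on (hint 0 (k t)) (fun s hs => ?_) hkt
    exact Ultra.sum_mul_truncPow_pos hm
      ⟨ht0.trans_le ((hτk s hs.1.le t ht0).2 hs.2), (hτI s).2⟩ hcard
      (fun a => sum_pad_sq e (x a)) ((pad_injective e).comp hx) hc
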